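/- All Lie superalgebras and modules are over $\mathbb C$. Let $\mathfrak g=\mathfrak g_0\oplus\mathfrak g_1$ be a finite-dimensional Lie superalgebra. A $\mathfrak g$-module is a superspace $M=M_0\oplus M_1$ on which $\mathfrak g$ acts compatibly with parity; $\mathcal F(\mathfrak g)$ denotes the category of finite-dimensional $\mathfrak g$-modules that are semisimple over $\mathfrak g_0$, with parity-preserving $\mathfrak g$-homomorphisms. Let $X=\{x\in\mathfrak g_1 : [x,x]=0\}$. For a $\mathfrak g$-module $M$ and $x\in X$, the action of $x$ on $M$ is an operator $x_M$ with $x_M^2=0$; put $M_x=\operatorname{Ker}x_M/x_M M$ and $X_M=\{x\in X : M_x\neq 0\}$. (1) Suppose that $\mathfrak g$ is quasireductive, that is, $\mathfrak g_0$ is a reductive Lie algebra and $\mathfrak g_1$ is a semisimple $\mathfrak g_0$-module, and that there is an element $h$ in the center of $\mathfrak g_0$ such that $\operatorname{ad}_h$ acts diagonally on $\mathfrak g_1$ with nonzero real eigenvalues. Then every $M\in\mathcal F(\mathfrak g)$ with $X_M=\{0\}$ is projective in $\mathcal F(\mathfrak g)$. (2) The Lie superalgebras $\mathfrak{gl}(m|n)$,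 $\mathfrak{sl}(m|n)$ with $m\neq n$, $\mathfrak{osp}(2|2n)$ and the periplectic Lie superalgebra $\mathfrak p(n)$ $(m,n\geq 0)$ satisfy the hypotheses of (1). Hence, for $\mathfrak g$ any of these, every $M\in\mathcal F(\mathfrak g)$ with $X_M=\{0\}$ is projective in $\mathcal F(\mathfrak g)$. -/

import Mathlib

universe u w

/-- A complex Lie superalgebra `𝔤 = 𝔤₀ ⊕ 𝔤₁`, presented by its homogeneous parts: a Lie algebra
`even`, an `even`-module `odd`, and a symmetric `even`-equivariant bilinear bracket
`odd × odd → even` satisfying the remaining (odd-odd-odd) super Jacobi identity. -/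
structure LieSuperalgebra where
  even : Type u
  odd : Type u
  [lieRing : LieRing even]
  [lieAlgebra : LieAlgebra ℂ even]
  [addCommGroup : AddCommGroup odd]
  [module : Module ℂ odd]
  [lieRingModule : LieRingModule even odd]
  [lieModule : LieModule ℂ even odd]
  bracket : odd →ₗ[ℂ] odd →ₗ[ℂ] even
  bracket_symm : ∀ x y : odd, bracket x y = bracket y x
  lie_bracket : ∀ (a : even) (x y : odd),
    ⁅a, bracket x y⁆ = bracket ⁅a, x⁆ y + bracket x ⁅a, y⁆
  jacobi_odd : ∀ x y z : odd,
    ⁅bracket x y, z⁆ + ⁅bracket y z, x⁆ + ⁅bracket z x, y⁆ = 0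

namespace LieSuperalgebra

attribute [instance] lieRing lieAlgebra addCommGroup module lieRingModule lieModule

/-- The self-commuting cone `X = {x ∈ 𝔤₁ | [x, x] = 0}`. -/
def selfCommutingCone (g : LieSuperalgebra.{u}) : Set g.odd :=
  {x | g.bracket x x = 0}

/-- A module over the Lie superalgebra `g`: a superspace `M = M₀ ⊕ M₁` on which `𝔤₀` acts by
even operators and `𝔤₁` acts by odd operators, compatibly with all brackets. -/
structure SuperModule (g : LieSuperalgebra.{u}) where
  even : Type w
  odd : Type w
  [addCommGroupEven : AddCommGroup even]
  [addCommGroupOdd : AddCommGroup odd]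
  [moduleEven : Module ℂ even]
  [moduleOdd : Module ℂ odd]
  [lieRingModuleEven : LieRingModule g.even even]
  [lieRingModuleOdd : LieRingModule g.even odd]
  [lieModuleEven : LieModule ℂ g.even even]
  [lieModuleOdd : LieModule ℂ g.even odd]
  /-- the action `𝔤₁ × M₀ → M₁` -/
  actEven : g.odd →ₗ[ℂ] even →ₗ[ℂ] odd
  /-- the action `𝔤₁ × M₁ → M₀` -/
  actOdd : g.odd →ₗ[ℂ] odd →ₗ[ℂ] even
  lie_actEven : ∀ (a : g.even) (x : g.odd) (m : even),
    ⁅a, actEven x m⁆ = actEven ⁅a, x⁆ m + actEven x ⁅a, m⁆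
  lie_actOdd : ∀ (a : g.even) (x : g.odd) (m : odd),
    ⁅a, actOdd x m⁆ = actOdd ⁅a, x⁆ m + actOdd x ⁅a, m⁆
  bracket_even : ∀ (x y : g.odd) (m : even),
    ⁅g.bracket x y, m⁆ = actOdd x (actEven y m) + actOdd y (actEven x m)
  bracket_odd : ∀ (x y : g.odd) (m : odd),
    ⁅g.bracket x y, m⁆ = actEven x (actOdd y m) + actEven y (actOdd x m)

namespace SuperModule

attribute [instance] addCommGroupEven addCommGroupOdd moduleEven moduleOdd
  lieRingModuleEven lieRingModuleOdd lieModuleEven lieModuleOdd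

variable {g : LieSuperalgebra.{u}}

/-- Morphisms of `g`-modules: parity-preserving linear maps commuting with `𝔤`. -/
@[ext]
structure Hom (M N : SuperModule.{u, w} g) where
  even : M.even →ₗ⁅ℂ, g.even⁆ N.even
  odd : M.odd →ₗ⁅ℂ, g.even⁆ N.odd
  map_actEven : ∀ (x : g.odd) (m : M.even), odd (M.actEven x m) = N.actEven x (even m)
  map_actOdd : ∀ (x : g.odd) (m : M.odd), even (M.actOdd x m) = N.actOdd x (odd m)

/-- The category `Mod(𝔤)` of `g`-modules. -/
instance category : CategoryTheory.Category (SuperModule.{u, w} g) where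
  Hom M N := Hom M N
  id _ := ⟨LieModuleHom.id, LieModuleHom.id, fun _ _ => rfl, fun _ _ => rfl⟩
  comp f h := ⟨h.even.comp f.even, h.odd.comp f.odd,
    fun x m => by simp [f.map_actEven, h.map_actEven],
    fun x m => by simp [f.map_actOdd, h.map_actOdd]⟩

/-- The operator `x_M` on the total space `M = M₀ ⊕ M₁` given by an odd element `x`. -/
def oddEnd (M : SuperModule.{u, w} g) (x : g.odd) : Module.End ℂ (M.even × M.odd) :=
  LinearMap.prod (M.actOdd x ∘ₗ LinearMap.snd ℂ M.even M.odd)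
    (M.actEven x ∘ₗ LinearMap.fst ℂ M.even M.odd)

/-- The space `M_x = Ker x_M / x M` (used for `x` in the self-commuting cone, where
`x M ⊆ Ker x_M`). -/
abbrev fiber (M : SuperModule.{u, w} g) (x : g.odd) : Type w :=
  LinearMap.ker (M.oddEnd x) ⧸
    (LinearMap.range (M.oddEnd x)).submoduleOf (LinearMap.ker (M.oddEnd x))

/-- The associated variety `X_M = {x ∈ X | M_x ≠ 0}`. -/
def associatedVariety (M : SuperModule.{u, w} g) : Set g.odd :=
  {x | x ∈ g.selfCommutingCone ∧ Nontrivial (M.fiber x)}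

end SuperModule

/-- Objects of `𝓕(𝔤)`: finite-dimensional `g`-modules `M = M₀ ⊕ M₁` that are semisimple
(completely reducible) over `𝔤₀`. -/
def isFinSemisimple (g : LieSuperalgebra.{u}) :
    CategoryTheory.ObjectProperty (SuperModule.{u, w} g) := fun M =>
  (FiniteDimensional ℂ M.even ∧ FiniteDimensional ℂ M.odd) ∧
    ComplementedLattice (LieSubmodule ℂ g.even M.even) ∧
    ComplementedLattice (LieSubmodule ℂ g.even M.odd)

/-- The category `𝓕(𝔤)`, a full subcategory of `Mod(𝔤)`. -/
abbrev FinSemisimple (g : LieSuperalgebra.{u}) :=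
  (isFinSemisimple.{u, w} g).FullSubcategory

/-- Every `M` in `𝓕(𝔤)` with `X_M = {0}` is projective in `𝓕(𝔤)`. -/
def VarietyDetectsProjectivity (g : LieSuperalgebra.{u}) : Prop :=
  ∀ M : FinSemisimple.{u, w} g,
    M.obj.associatedVariety = {0} → CategoryTheory.Projective M

/-- `𝔤` is quasireductive: it is finite-dimensional, `𝔤₀` is a reductive Lie algebra, and `𝔤₁`
is a semisimple `𝔤₀`-module. -/
structure IsQuasireductive (g : LieSuperalgebra.{u}) : Prop where
  finite_even : FiniteDimensional ℂ g.even
  finite_odd : FiniteDimensional ℂ g.odd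
  reductive : LieAlgebra.HasCentralRadical ℂ g.even
  semisimple_odd : ComplementedLattice (LieSubmodule ℂ g.even g.odd)

/-- There is a central `h ∈ 𝔤₀` such that `ad h` is diagonalizable on `𝔤₁` with nonzero real
eigenvalues. -/
def HasRealGradingElement (g : LieSuperalgebra.{u}) : Prop :=
  ∃ h ∈ LieAlgebra.center ℂ g.even,
    ∃ (b : Module.Basis (Fin (Module.finrank ℂ g.odd)) ℂ g.odd)
      (c : Fin (Module.finrank ℂ g.odd) → ℝ),
      ∀ i, c i ≠ 0 ∧ ⁅h, b i⁆ = (c i : ℂ) • b i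

section Concrete

/-- The Lie superalgebra `k₀ ⊕ k₁` inside an associative algebra `A`: brackets involving an even
element are commutators, the bracket of two odd elements is the anticommutator. -/
def ofAssociative {A : Type u} [Ring A] [Algebra ℂ A] (k₀ k₁ : Submodule ℂ A)
    (h₀₀ : ∀ a ∈ k₀, ∀ b ∈ k₀, a * b - b * a ∈ k₀)
    (h₀₁ : ∀ a ∈ k₀, ∀ x ∈ k₁, a * x - x * a ∈ k₁)
    (h₁₁ : ∀ x ∈ k₁, ∀ y ∈ k₁, x * y + y * x ∈ k₀) : LieSuperalgebra.{u} :=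
  letI i₁ : LieRing k₀ :=
    { bracket := fun a b => ⟨a.1 * b.1 - b.1 * a.1, h₀₀ _ a.2 _ b.2⟩
      add_lie := fun a b c => Subtype.ext (by simp; noncomm_ring)
      lie_add := fun a b c => Subtype.ext (by simp; noncomm_ring)
      lie_self := fun a => Subtype.ext (by simp)
      leibniz_lie := fun a b c => Subtype.ext (by simp; noncomm_ring) }
  letI i₂ : LieAlgebra ℂ k₀ :=
    { lie_smul := fun t a b => Subtype.ext (by
        change a.1 * (t • b.1) - (t • b.1) * a.1 = t • (a.1 * b.1 - b.1 * a.1)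
        simp [smul_sub]) }
  letI i₃ : LieRingModule k₀ k₁ :=
    { bracket := fun a x => ⟨a.1 * x.1 - x.1 * a.1, h₀₁ _ a.2 _ x.2⟩
      add_lie := fun a b c => Subtype.ext (by simp; noncomm_ring)
      lie_add := fun a b c => Subtype.ext (by simp; noncomm_ring)
      leibniz_lie := fun a b x => Subtype.ext (by
        change a.1 * (b.1 * x.1 - x.1 * b.1) - (b.1 * x.1 - x.1 * b.1) * a.1 =
          (a.1 * b.1 - b.1 * a.1) * x.1 - x.1 * (a.1 * b.1 - b.1 * a.1) +
          (b.1 * (a.1 * x.1 - x.1 * a.1) - (a.1 * x.1 - x.1 * a.1) * b.1)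
        noncomm_ring) }
  letI i₄ : LieModule ℂ k₀ k₁ :=
    { smul_lie := fun t a x => Subtype.ext (by
        change (t • a.1) * x.1 - x.1 * (t • a.1) = t • (a.1 * x.1 - x.1 * a.1)
        simp [smul_sub])
      lie_smul := fun t a x => Subtype.ext (by
        change a.1 * (t • x.1) - (t • x.1) * a.1 = t • (a.1 * x.1 - x.1 * a.1)
        simp [smul_sub]) }
  { even := k₀
    odd := k₁
    bracket := LinearMap.mk₂ ℂ (fun x y => ⟨x.1 * y.1 + y.1 * x.1, h₁₁ _ x.2 _ y.2⟩)
      (fun x y z => Subtype.ext (by simp; noncomm_ring))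
      (fun t x y => Subtype.ext (by simp))
      (fun x y z => Subtype.ext (by simp; noncomm_ring))
      (fun t x y => Subtype.ext (by simp))
    bracket_symm := fun x y => Subtype.ext (by simp [add_comm])
    lie_bracket := fun a x y => Subtype.ext (by
      change a.1 * (x.1 * y.1 + y.1 * x.1) - (x.1 * y.1 + y.1 * x.1) * a.1 =
        ((a.1 * x.1 - x.1 * a.1) * y.1 + y.1 * (a.1 * x.1 - x.1 * a.1)) +
        (x.1 * (a.1 * y.1 - y.1 * a.1) + (a.1 * y.1 - y.1 * a.1) * x.1)
      noncomm_ring)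
    jacobi_odd := fun x y z => Subtype.ext (by
      change ((x.1 * y.1 + y.1 * x.1) * z.1 - z.1 * (x.1 * y.1 + y.1 * x.1)) +
        ((y.1 * z.1 + z.1 * y.1) * x.1 - x.1 * (y.1 * z.1 + z.1 * y.1)) +
        ((z.1 * x.1 + x.1 * z.1) * y.1 - y.1 * (z.1 * x.1 + x.1 * z.1)) = 0
      noncomm_ring) }

open Matrix

/-- Complex square matrices of size `m + n`, in blocks. -/
abbrev BlockMatrix (p q : Type) := Matrix (p ⊕ q) (p ⊕ q) ℂ

/-- The block diagonal matrices `diag(A, D)` with `(A, D)` in a given subspace. -/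
def blockDiag {p q : Type} (S : Submodule ℂ (Matrix p p ℂ × Matrix q q ℂ)) :
    Submodule ℂ (BlockMatrix p q) where
  carrier := {X | ∃ A D, (A, D) ∈ S ∧ X = fromBlocks A 0 0 D}
  zero_mem' := ⟨0, 0, S.zero_mem, by simp⟩
  add_mem' := by
    rintro _ _ ⟨A, D, h, rfl⟩ ⟨A', D', h', rfl⟩
    exact ⟨A + A', D + D', S.add_mem h h', by simp [fromBlocks_add]⟩
  smul_mem' := by
    rintro t _ ⟨A, D, h, rfl⟩
    exact ⟨t • A, t • D, S.smul_mem t h, by simp [fromBlocks_smul]⟩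

/-- The block off-diagonal matrices with upper right block `B` and lower left block `C`, for
`(B, C)` in a given subspace. -/
def blockOffDiag {p q : Type} (S : Submodule ℂ (Matrix p q ℂ × Matrix q p ℂ)) :
    Submodule ℂ (BlockMatrix p q) where
  carrier := {X | ∃ B C, (B, C) ∈ S ∧ X = fromBlocks 0 B C 0}
  zero_mem' := ⟨0, 0, S.zero_mem, by simp⟩
  add_mem' := by
    rintro _ _ ⟨A, D, h, rfl⟩ ⟨A', D', h', rfl⟩
    exact ⟨A + A', D + D', S.add_mem h h', by simp [fromBlocks_add]⟩
  smul_mem' := by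
    rintro t _ ⟨A, D, h, rfl⟩
    exact ⟨t • A, t • D, S.smul_mem t h, by simp [fromBlocks_smul]⟩

/-- The Lie superalgebra of block matrices with even part the `diag(A, D)`, `(A, D) ∈ S₀`, and
odd part the off-diagonal matrices with blocks `(B, C) ∈ S₁`. -/
def ofBlocks {p q : Type} [Fintype p] [Fintype q] [DecidableEq p] [DecidableEq q]
    (S₀ : Submodule ℂ (Matrix p p ℂ × Matrix q q ℂ))
    (S₁ : Submodule ℂ (Matrix p q ℂ × Matrix q p ℂ))
    (h₀₀ : ∀ A D A' D', (A, D) ∈ S₀ → (A', D') ∈ S₀ →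
      (A * A' - A' * A, D * D' - D' * D) ∈ S₀)
    (h₀₁ : ∀ A D B C, (A, D) ∈ S₀ → (B, C) ∈ S₁ → (A * B - B * D, D * C - C * A) ∈ S₁)
    (h₁₁ : ∀ B C B' C', (B, C) ∈ S₁ → (B', C') ∈ S₁ →
      (B * C' + B' * C, C * B' + C' * B) ∈ S₀) : LieSuperalgebra.{0} :=
  ofAssociative (blockDiag S₀) (blockOffDiag S₁)
    (by
      rintro _ ⟨A, D, h, rfl⟩ _ ⟨A', D', h', rfl⟩
      exact ⟨_, _, h₀₀ _ _ _ _ h h', by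
        simp [fromBlocks_multiply, sub_eq_add_neg, fromBlocks_neg, fromBlocks_add]⟩)
    (by
      rintro _ ⟨A, D, h, rfl⟩ _ ⟨B, C, h', rfl⟩
      exact ⟨_, _, h₀₁ _ _ _ _ h h', by
        simp [fromBlocks_multiply, sub_eq_add_neg, fromBlocks_neg, fromBlocks_add]⟩)
    (by
      rintro _ ⟨B, C, h, rfl⟩ _ ⟨B', C', h', rfl⟩
      exact ⟨_, _, h₁₁ _ _ _ _ h h', by simp [fromBlocks_multiply, fromBlocks_add]⟩)

/-- The general linear Lie superalgebra `𝔤𝔩(m|n)`. -/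
def gl (m n : ℕ) : LieSuperalgebra.{0} :=
  ofBlocks (p := Fin m) (q := Fin n) ⊤ ⊤ (by simp) (by simp) (by simp)

/-- The special linear Lie superalgebra `𝔰𝔩(m|n)`: supertrace `tr A - tr D` equal to zero. -/
def sl (m n : ℕ) : LieSuperalgebra.{0} :=
  ofBlocks (p := Fin m) (q := Fin n)
    { carrier := {X | trace X.1 - trace X.2 = 0}
      zero_mem' := by simp
      add_mem' := by
        intro X Y hX hY
        simp only [Set.mem_ofPred_eq, Prod.fst_add, Prod.snd_add, trace_add] at *
        linear_combination hX + hY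
      smul_mem' := by
        intro t X hX
        simp only [Set.mem_ofPred_eq, Prod.smul_fst, Prod.smul_snd, trace_smul] at *
        rw [← smul_sub, hX, smul_zero] }
    ⊤
    (by
      intro A D A' D' _ _
      change trace (A * A' - A' * A) - trace (D * D' - D' * D) = 0
      simp [trace_sub, trace_mul_comm A, trace_mul_comm D])
    (by simp)
    (by
      intro B C B' C' _ _
      change trace (B * C' + B' * C) - trace (C * B' + C' * B) = 0
      rw [trace_add, trace_add, trace_mul_comm B, trace_mul_comm B']
      ring)

/-- The orthosymplectic Lie superalgebra `𝔬𝔰𝔭(m|2n)`: the endomorphisms `X` of `ℂ^{m|2n}` with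
`(X u, v) + (-1)^{|X||u|} (u, X v) = 0` for the even form `(u, v) = uᵀ v` on the even part and
`(u, v) = uᵀ J v` on the odd part, `J` being the standard symplectic matrix. In blocks:
`Aᵀ + A = 0`, `Dᵀ J + J D = 0`, and `Bᵀ = J C`. -/
def osp (m n : ℕ) : LieSuperalgebra.{0} :=
  ofBlocks (p := Fin m) (q := Fin n ⊕ Fin n)
    { carrier := {X | X.1ᵀ + X.1 = 0 ∧ X.2ᵀ * J (Fin n) ℂ + J (Fin n) ℂ * X.2 = 0}
      zero_mem' := by simp
      add_mem' := by
        rintro X Y ⟨h₁, h₂⟩ ⟨h₃, h₄⟩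
        refine ⟨?_, ?_⟩
        · rw [Prod.fst_add, transpose_add, add_add_add_comm, h₁, h₃, add_zero]
        · rw [Prod.snd_add, transpose_add, add_mul, mul_add, add_add_add_comm, h₂, h₄, add_zero]
      smul_mem' := by
        rintro t X ⟨h₁, h₂⟩
        refine ⟨?_, ?_⟩
        · rw [Prod.smul_fst, transpose_smul, ← smul_add, h₁, smul_zero]
        · rw [Prod.smul_snd, transpose_smul, Matrix.smul_mul, Matrix.mul_smul, ← smul_add, h₂, smul_zero] }
    { carrier := {X | X.1ᵀ = J (Fin n) ℂ * X.2}
      zero_mem' := by simp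
      add_mem' := by
        intro X Y h₁ h₂
        simp only [Set.mem_ofPred_eq, Prod.fst_add, Prod.snd_add, transpose_add, Matrix.mul_add] at *
        rw [h₁, h₂]
      smul_mem' := by
        intro t X h₁
        simp only [Set.mem_ofPred_eq, Prod.smul_fst, Prod.smul_snd, transpose_smul,
          Matrix.mul_smul] at *
        rw [h₁] }
    (by
      rintro A D A' D' ⟨h₁, h₂⟩ ⟨h₃, h₄⟩
      have h₁' : Aᵀ = -A := eq_neg_of_add_eq_zero_left h₁
      have h₃' : A'ᵀ = -A' := eq_neg_of_add_eq_zero_left h₃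
      have h₂' : Dᵀ * J (Fin n) ℂ = -(J (Fin n) ℂ * D) := eq_neg_of_add_eq_zero_left h₂
      have h₄' : D'ᵀ * J (Fin n) ℂ = -(J (Fin n) ℂ * D') := eq_neg_of_add_eq_zero_left h₄
      refine ⟨?_, ?_⟩
      · simp only [transpose_sub, transpose_mul, h₁', h₃']
        noncomm_ring
      · simp only [transpose_sub, transpose_mul, sub_mul, Matrix.mul_assoc, h₂', h₄']
        simp only [mul_neg, ← Matrix.mul_assoc, h₂', h₄']
        noncomm_ring)
    (by
      rintro A D B C ⟨h₁, h₂⟩ h₃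
      have h₁' : Aᵀ = -A := eq_neg_of_add_eq_zero_left h₁
      have h₂' : Dᵀ * J (Fin n) ℂ = -(J (Fin n) ℂ * D) := eq_neg_of_add_eq_zero_left h₂
      have h₃' : Bᵀ = J (Fin n) ℂ * C := h₃
      change (A * B - B * D)ᵀ = J (Fin n) ℂ * (D * C - C * A)
      simp only [transpose_sub, transpose_mul, h₁', h₃', Matrix.mul_sub, Matrix.mul_neg,
        Matrix.mul_assoc]
      rw [← Matrix.mul_assoc Dᵀ, h₂', Matrix.neg_mul, Matrix.mul_assoc]
      abel)
    (by
      intro B C B' C' h₁ h₂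
      have h₁' : Bᵀ = J (Fin n) ℂ * C := h₁
      have h₂' : B'ᵀ = J (Fin n) ℂ * C' := h₂
      have k₁ : B = -(Cᵀ * J (Fin n) ℂ) := by
        rw [← transpose_transpose B, h₁', transpose_mul, J_transpose, Matrix.mul_neg]
      have k₂ : B' = -(C'ᵀ * J (Fin n) ℂ) := by
        rw [← transpose_transpose B', h₂', transpose_mul, J_transpose, Matrix.mul_neg]
      refine ⟨?_, ?_⟩
      · change (B * C' + B' * C)ᵀ + (B * C' + B' * C) = 0
        rw [transpose_add, transpose_mul, transpose_mul, h₁', h₂', k₁, k₂]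
        simp only [Matrix.neg_mul, Matrix.mul_assoc]
        abel
      · change (C * B' + C' * B)ᵀ * J (Fin n) ℂ + J (Fin n) ℂ * (C * B' + C' * B) = 0
        rw [transpose_add, transpose_mul, transpose_mul, h₁', h₂', k₁, k₂]
        simp only [Matrix.mul_neg, Matrix.mul_assoc, Matrix.add_mul, Matrix.mul_add]
        abel)

/-- The periplectic Lie superalgebra `𝔭(n)`: blocks `A, B, C, -Aᵀ` with `B` symmetric and `C`
skew-symmetric. -/
def periplectic (n : ℕ) : LieSuperalgebra.{0} :=
  ofBlocks (p := Fin n) (q := Fin n)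
    { carrier := {X | X.2 = -X.1ᵀ}
      zero_mem' := by simp
      add_mem' := by
        intro X Y h₁ h₂
        simp only [Set.mem_ofPred_eq, Prod.fst_add, Prod.snd_add, transpose_add] at *
        rw [h₁, h₂, neg_add]
      smul_mem' := by
        intro t X h₁
        simp only [Set.mem_ofPred_eq, Prod.smul_fst, Prod.smul_snd, transpose_smul] at *
        rw [h₁, smul_neg] }
    { carrier := {X | X.1ᵀ = X.1 ∧ X.2ᵀ = -X.2}
      zero_mem' := by simp
      add_mem' := by
        rintro X Y ⟨h₁, h₂⟩ ⟨h₃, h₄⟩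
        refine ⟨?_, ?_⟩
        · rw [Prod.fst_add, transpose_add, h₁, h₃]
        · rw [Prod.snd_add, transpose_add, h₂, h₄, neg_add]
      smul_mem' := by
        rintro t X ⟨h₁, h₂⟩
        refine ⟨?_, ?_⟩
        · rw [Prod.smul_fst, transpose_smul, h₁]
        · rw [Prod.smul_snd, transpose_smul, h₂, smul_neg] }
    (by
      intro A D A' D' h₁ h₂
      have h₁' : D = -Aᵀ := h₁
      have h₂' : D' = -A'ᵀ := h₂
      change D * D' - D' * D = -(A * A' - A' * A)ᵀ
      simp only [h₁', h₂', transpose_sub, transpose_mul]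
      noncomm_ring)
    (by
      rintro A D B C h₁ ⟨h₂, h₃⟩
      have h₁' : D = -Aᵀ := h₁
      have h₂' : Bᵀ = B := h₂
      have h₃' : Cᵀ = -C := h₃
      refine ⟨?_, ?_⟩
      · change (A * B - B * D)ᵀ = A * B - B * D
        simp only [h₁', h₂', transpose_sub, transpose_mul, transpose_neg, transpose_transpose]
        noncomm_ring
      · change (D * C - C * A)ᵀ = -(D * C - C * A)
        simp only [h₁', h₃', transpose_sub, transpose_mul, transpose_neg, transpose_transpose]
        noncomm_ring)
    (by
      rintro B C B' C' ⟨h₁, h₂⟩ ⟨h₃, h₄⟩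
      have h₁' : Bᵀ = B := h₁
      have h₂' : Cᵀ = -C := h₂
      have h₃' : B'ᵀ = B' := h₃
      have h₄' : C'ᵀ = -C' := h₄
      change C * B' + C' * B = -(B * C' + B' * C)ᵀ
      simp only [h₁', h₂', h₃', h₄', transpose_add, transpose_mul]
      noncomm_ring)

end Concrete

end LieSuperalgebra

/-! Let `h` be the grading element. The odd part is the sum of the span `W` of the positive weight
vectors and the span `W'` of the negative ones. Since `h` is central in the even part, it acts by
zero on brackets of odd elements, so `W` and `W'` are stable under the even part and have zero
bracket. Their elements therefore lie in the self-commuting cone, and the hypothesis on the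
associated variety says that each nonzero `x` in `W` or `W'` acts on `M` with kernel equal to image.

The exterior algebra criterion (`invariants_and_cocycles_of_exact`) turns this pointwise exactness
into a form of freeness over `Λ(W)` and `Λ(W')`: the vectors killed by `W` are the image of the top
product `ω` of `W`. Dually (`mem_iSup_range_of_opProd_eq_zero`), the kernel of the top product `ω'`
of `W'` is contained in `W' M`.

Projectivity is obtained by a Higman-type argument. Let the top products of `W'` and then `W` act by
supercommutators on a linear map that transforms under the even part by the inverse of the character
of `Λᵗᵒᵖ W ⊗ Λᵗᵒᵖ W'`. The result is invariant (`opProd_opProd_invariant`); symmetrized for parity,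
it is a homomorphism, the relative trace. Surjections in the category split over the even part, so a
trace can be lifted along any surjection: trace the map lifted by the splitting
(`isLiftable_relTrace`). Liftable endomorphisms are closed under sums and under composition with
homomorphisms on either side, and it remains to see that the identity is liftable.

Let `e` be a nonzero idempotent endomorphism and `l` a weight of `e M` with maximal real part.
Vectors of weight `l` in `e M` are killed by `W`, hence lie in the image of `ω`, and `ω'` is
injective on them. Take a generalized inverse `t₁` of `ω' ω`, equivariant up to the twist and cut
down to a single weight space. By weight considerations its trace, followed by `e`, acts on these
vectors as a nonzero multiple of `e ω t₁ ω'`, which is the identity there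
(`exists_isLiftable_apply_eq_smul`). A polynomial in the resulting endomorphism enlarges any
liftable idempotent other than `1`, so one of maximal rank is the identity (`isLiftable_one`).

For the concrete families, reductivity and semisimplicity follow from closure of the even part under
conjugate transposition, and `h` is an explicit block-diagonal matrix. -/

section OperatorProduct

/-! ### Products of square-zero operators as alternating maps. -/

variable {K W M : Type*} [Field K] [AddCommGroup W] [Module K W] [AddCommGroup M] [Module K M]

/-- An alternating map of top degree is determined up to the determinant by its value on a
basis. -/
theorem AlternatingMap.apply_eq_det_smul {ι N : Type*} [Fintype ι] [DecidableEq ι]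
    [AddCommGroup N] [Module K N] (f : W [⋀^ι]→ₗ[K] N) (e : Module.Basis ι K W) (v : ι → W) :
    f v = e.det v • f e := by
  have : f = (LinearMap.toSpanSingleton K N (f e)).compAlternatingMap e.det := by
    -- It is enough to compare on injective tuples of basis vectors. Here these are permutations of
    -- the basis, and both sides acquire the same sign.
    refine e.ext_alternating fun w hw => ?_
    let σ : Equiv.Perm ι := Equiv.ofBijective w (Finite.injective_iff_bijective.mp hw)
    have h₁ := f.map_perm e σ
    have h₂ := e.det.map_perm e σ
    have h : (fun i => e (w i)) = ⇑e ∘ ⇑σ := rfl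
    rw [h, LinearMap.compAlternatingMap_apply, h₁, h₂, Module.Basis.det_self,
      LinearMap.toSpanSingleton_apply]
    rcases Int.units_eq_one_or (Equiv.Perm.sign σ) with h | h <;> simp [h]
  conv_lhs => rw [this]
  simp

/-- The product `ρ v₀ ∘ ρ v₁ ∘ ⋯` of the operators attached to a tuple of vectors. -/
def opProd (ρ : W →ₗ[K] Module.End K M) {k : ℕ} (v : Fin k → W) : Module.End K M :=
  (List.ofFn fun i => ρ (v i)).prod

@[simp]
theorem opProd_zero (ρ : W →ₗ[K] Module.End K M) (v : Fin 0 → W) : opProd ρ v = 1 := by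
  simp [opProd]

theorem opProd_cons (ρ : W →ₗ[K] Module.End K M) {k : ℕ} (x : W) (v : Fin k → W) :
    opProd ρ (Fin.cons x v : Fin (k + 1) → W) = ρ x * opProd ρ v := by
  simp [opProd, List.ofFn_succ]

theorem opProd_succ (ρ : W →ₗ[K] Module.End K M) {k : ℕ} (v : Fin (k + 1) → W) :
    opProd ρ v = ρ (v 0) * opProd ρ (fun i => v i.succ) := by
  simp [opProd, List.ofFn_succ]

/-- If all `ρ x` have square zero, the operator product is an alternating map. -/
theorem exists_alternatingMap_eq_opProd (ρ : W →ₗ[K] Module.End K M)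
    (hρ : ∀ x, ρ x * ρ x = 0) (k : ℕ) :
    ∃ f : W [⋀^Fin k]→ₗ[K] Module.End K M, ∀ v, f v = opProd ρ v := by
  -- The square-zero condition is the universal property of the exterior algebra.
  refine ⟨(ExteriorAlgebra.lift K ⟨ρ, hρ⟩).toLinearMap.compAlternatingMap
    (ExteriorAlgebra.ιMulti K k), fun v => ?_⟩
  simp only [LinearMap.compAlternatingMap_apply, ExteriorAlgebra.ιMulti_apply,
    AlgHom.toLinearMap_apply, map_list_prod, List.map_ofFn, opProd]
  congr 2
  funext i
  simp

theorem opProd_eq_det_smul (ρ : W →ₗ[K] Module.End K M) (hρ : ∀ x, ρ x * ρ x = 0) {k : ℕ}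
    (e : Module.Basis (Fin k) K W) (v : Fin k → W) : opProd ρ v = e.det v • opProd ρ e := by
  obtain ⟨f, hf⟩ := exists_alternatingMap_eq_opProd ρ hρ k
  rw [← hf, ← hf, f.apply_eq_det_smul e]

theorem range_opProd_le (ρ : W →ₗ[K] Module.End K M) (hρ : ∀ x, ρ x * ρ x = 0) {k : ℕ}
    (e : Module.Basis (Fin k) K W) (v : Fin k → W) :
    LinearMap.range (opProd ρ v) ≤ LinearMap.range (opProd ρ e) := by
  rintro _ ⟨m, rfl⟩
  exact ⟨e.det v • m, by rw [opProd_eq_det_smul ρ hρ e v]; simp⟩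

theorem opProd_eq_zero_of_not_injective (ρ : W →ₗ[K] Module.End K M)
    (hρ : ∀ x, ρ x * ρ x = 0) {k : ℕ} (v : Fin k → W) (hv : ¬ Function.Injective v) :
    opProd ρ v = 0 := by
  obtain ⟨f, hf⟩ := exists_alternatingMap_eq_opProd ρ hρ k
  rw [← hf]
  exact f.map_eq_zero_of_not_injective v hv

/-- The product over a basis is killed by all `ρ x`. -/
theorem mul_opProd_basis_eq_zero (ρ : W →ₗ[K] Module.End K M) (hρ : ∀ x, ρ x * ρ x = 0) {k : ℕ}
    (e : Module.Basis (Fin k) K W) (x : W) : ρ x * opProd ρ e = 0 := by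
  rw [← e.sum_repr x, map_sum, Finset.sum_mul]
  refine Finset.sum_eq_zero fun i _ => ?_
  rw [map_smul, smul_mul_assoc, ← opProd_cons, opProd_eq_zero_of_not_injective ρ hρ, smul_zero]
  intro h
  have := h (a₁ := 0) (a₂ := i.succ) (by simp)
  exact Fin.succ_ne_zero i this.symm

end OperatorProduct

/-! ### Modules over an exterior algebra on which every nonzero vector acts exactly. -/

section ExteriorRankVariety

open Module

/-- Let `A` and `B` be linear maps with kernel containing `R`, with equality for `A`, such that `B`
takes values in the range of `A`. If all `B - c A` have kernel inside `R`, then `R` is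
everything. -/
theorem eq_top_of_pencil {K V H : Type*} [Field K] [IsAlgClosed K] [AddCommGroup V] [Module K V]
    [FiniteDimensional K V] [AddCommGroup H] [Module K H] (A B : V →ₗ[K] H) (R : Submodule K V)
    (hA : LinearMap.ker A = R) (hB : R ≤ LinearMap.ker B)
    (hAB : LinearMap.range B ≤ LinearMap.range A)
    (hker : ∀ c : K, LinearMap.ker (B - c • A) ≤ R) : R = ⊤ := by
  -- Factor `B` as `A ∘ T`. Then `T` preserves `R = ker A` and acts on `V ⧸ R`. An eigenvector
  -- there, with eigenvalue `c`, is represented by some `v` with `T v - c v ∈ ker A`, so `v` lies in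
  -- the kernel of `B - c A`, hence in `R`: a contradiction unless `V ⧸ R` is zero.
  have hT : ∃ T : V →ₗ[K] V, A ∘ₗ T = B := by
    obtain ⟨s, hs⟩ := A.rangeRestrict.exists_rightInverse_of_surjective A.range_rangeRestrict
    refine ⟨s ∘ₗ B.codRestrict (LinearMap.range A) fun v => hAB ⟨v, rfl⟩, ?_⟩
    ext v
    have := congrArg Subtype.val
      (LinearMap.congr_fun hs (B.codRestrict (LinearMap.range A) (fun v => hAB ⟨v, rfl⟩) v))
    simpa using this
  obtain ⟨T, hT⟩ := hT
  have hRT : R ≤ R.comap T := fun r hr => hA.le (by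
    have : B r = 0 := hB hr
    rw [← hT] at this
    simpa using this)
  by_contra hR
  have : Nontrivial (V ⧸ R) := Submodule.Quotient.nontrivial_iff.mpr hR
  obtain ⟨c, hc⟩ := Module.End.exists_eigenvalue (R.mapQ R T hRT)
  obtain ⟨q, hq, hq0⟩ := hc.exists_hasEigenvector
  obtain ⟨v, rfl⟩ := R.mkQ_surjective q
  have h₁ : T v - c • v ∈ R := by
    rw [Module.End.mem_eigenspace_iff] at hq
    simp only [Submodule.mkQ_apply, Submodule.mapQ_apply] at hq
    rw [← Submodule.Quotient.mk_smul, Submodule.Quotient.eq] at hq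
    exact hq
  refine hq0 ((Submodule.Quotient.mk_eq_zero R).mpr (hker c ?_))
  have h : A (T v - c • v) = 0 := hA.ge h₁
  rw [map_sub, map_smul] at h
  rw [LinearMap.mem_ker, ← hT]
  simpa using h

variable {K : Type*} [Field K] {M : Type*} [AddCommGroup M] [Module K M]

/-- A basis of a hyperplane together with a vector outside it. -/
theorem exists_basis_cons_of_ker {W : Type*} [AddCommGroup W] [Module K W] {d : ℕ}
    (ξ : Module.Dual K W) (x₀ : W) (hx₀ : ξ x₀ = 1) (b' : Basis (Fin d) K (LinearMap.ker ξ)) :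
    ∃ e : Basis (Fin (d + 1)) K W, ⇑e = Fin.cons x₀ (Subtype.val ∘ ⇑b') := by
  refine ⟨Basis.mkFinCons x₀ b' (fun c x hx h => ?_) fun z => ⟨-ξ z, ?_⟩,
    Basis.coe_mkFinCons _ _ _ _⟩
  · have := congrArg ξ h
    rw [map_add, map_smul, hx₀, LinearMap.mem_ker.mp hx] at this
    simpa using this
  · simp [hx₀]

section Hyperplane

variable {W : Type*} [AddCommGroup W] [Module K W] (ρ : W →ₗ[K] Module.End K M)
  (hρ : ∀ x, ρ x * ρ x = 0) (ξ : Module.Dual K W) (x₀ : W) (hx₀ : ξ x₀ = 1)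

include hρ hx₀

/-- Subtracting the coboundary that agrees with `D` on the hyperplane leaves a cocycle `ξ ⊗ m`. The
cocycle condition makes `ρ x` kill `m` whenever `ξ x ≠ 0`, and any other `x` is the difference of `x
+ x₀` and `x₀`. -/
theorem exists_eq_smul_add_of_cocycle
    (hH : ∀ D : LinearMap.ker ξ →ₗ[K] M, (∀ x, ρ x.1 (D x) = 0) → ∃ m, ∀ x, D x = ρ x.1 m)
    (D : W →ₗ[K] M) (hD : ∀ x, ρ x (D x) = 0) :
    ∃ m n : M, (∀ x, ρ x m = 0) ∧ ∀ x, D x = ξ x • m + ρ x n := by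
  obtain ⟨n, hn⟩ := hH (D.domRestrict (LinearMap.ker ξ)) fun x => hD x.1
  have key : ∀ x, D x = ξ x • (D x₀ - ρ x₀ n) + ρ x n := by
    intro x
    have h := hn ⟨x - ξ x • x₀, by simp [hx₀]⟩
    simp only [LinearMap.domRestrict_apply, map_sub, map_smul, LinearMap.sub_apply,
      LinearMap.smul_apply] at h
    rw [sub_eq_iff_eq_add] at h
    rw [h, smul_sub]
    abel
  have hm : ∀ x, ξ x ≠ 0 → ρ x (D x₀ - ρ x₀ n) = 0 := by
    intro x hx
    have h := hD x
    rw [key x, map_add, map_smul, ← Module.End.mul_apply, hρ, LinearMap.zero_apply,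
      add_zero] at h
    exact (smul_eq_zero.mp h).resolve_left hx
  refine ⟨D x₀ - ρ x₀ n, n, fun x => ?_, key⟩
  by_cases hx : ξ x = 0
  · have h₁ := hm (x + x₀) (by rw [map_add, hx, hx₀, zero_add]; exact one_ne_zero)
    rw [map_add, LinearMap.add_apply, hm x₀ (by rw [hx₀]; exact one_ne_zero), add_zero] at h₁
    exact h₁
  · exact hm x hx

/-- If `ξ ⊗ m` is the coboundary of `n`, then `n` is invariant under the hyperplane, so `n` is a top
product of the hyperplane applied to some `k`, and `m = x₀ n` has one more factor. -/
theorem mem_range_opProd_of_smul_eq {d : ℕ} (b : Basis (Fin (d + 1)) K W)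
    (b' : Basis (Fin d) K (LinearMap.ker ξ))
    (hH : ∀ m, (∀ x ∈ LinearMap.ker ξ, ρ x m = 0) →
      m ∈ LinearMap.range (opProd ρ (Subtype.val ∘ ⇑b')))
    (m n : M) (h : ∀ x, ξ x • m = ρ x n) : m ∈ LinearMap.range (opProd ρ b) := by
  obtain ⟨k, rfl⟩ := hH n fun x hx => by rw [← h, LinearMap.mem_ker.mp hx, zero_smul]
  have hm : m = ρ x₀ (opProd ρ (Subtype.val ∘ ⇑b') k) := by rw [← h, hx₀, one_smul]
  refine range_opProd_le ρ hρ b (Fin.cons x₀ (Subtype.val ∘ ⇑b')) ⟨k, ?_⟩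
  rw [opProd_cons, hm]
  rfl

/-- Write `m = x₀ n` with `n` in the image of the top product of the hyperplane. The hyperplane
kills `n`, so `x n` depends on `ξ x` only. -/
theorem exists_smul_eq_of_mem_range_opProd {d : ℕ} (b : Basis (Fin (d + 1)) K W)
    (b' : Basis (Fin d) K (LinearMap.ker ξ)) (m : M) (hm : m ∈ LinearMap.range (opProd ρ b)) :
    ∃ n, ∀ x, ξ x • m = ρ x n := by
  obtain ⟨e, he⟩ := exists_basis_cons_of_ker ξ x₀ hx₀ b'
  obtain ⟨k, rfl⟩ := range_opProd_le ρ hρ e b hm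
  refine ⟨opProd ρ (Subtype.val ∘ ⇑b') k, fun x => ?_⟩
  rw [he, opProd_cons]
  have hx : x = ξ x • x₀ + (⟨x - ξ x • x₀, by simp [hx₀]⟩ : LinearMap.ker ξ).1 := by simp
  have h0 := mul_opProd_basis_eq_zero (ρ.domRestrict (LinearMap.ker ξ)) (fun x => hρ x.1) b'
    ⟨x - ξ x • x₀, by simp [hx₀]⟩
  have h0' := LinearMap.congr_fun h0 k
  conv_rhs => rw [hx, map_add, map_smul]
  rw [LinearMap.add_apply, LinearMap.smul_apply, Module.End.mul_apply]
  exact (add_eq_left.mpr h0').symm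

end Hyperplane

/-- Suppose that the finite-dimensional space `W` acts on `M` by operators of square zero, and that
every nonzero `x ∈ W` acts with `Ker x = Im x`. Then the `W`-invariants are the image of the top
exterior power of `W`, and every cocycle `W → M` is a coboundary. -/
theorem invariants_and_cocycles_of_exact [IsAlgClosed K] [FiniteDimensional K M] (d : ℕ) :
    ∀ {W : Type*} [AddCommGroup W] [Module K W] (ρ : W →ₗ[K] Module.End K M)
      (_ : ∀ x, ρ x * ρ x = 0) (_ : ∀ x, x ≠ 0 → LinearMap.ker (ρ x) ≤ LinearMap.range (ρ x))
      (b : Basis (Fin d) K W),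
      (∀ m, (∀ x, ρ x m = 0) → m ∈ LinearMap.range (opProd ρ b)) ∧
      ∀ D : W →ₗ[K] M, (∀ x, ρ x (D x) = 0) → ∃ m, ∀ x, D x = ρ x m := by
  induction d with
  | zero =>
    intro W _ _ ρ hρ hex b
    refine ⟨fun m _ => ⟨m, by simp⟩, fun D _ => ⟨0, fun x => ?_⟩⟩
    have : x = 0 := by rw [← b.sum_repr x]; simp
    simp [this]
  | succ d ih =>
    intro W _ _ ρ hρ hex b
    have hW : finrank K W = d + 1 := by simpa using finrank_eq_card_basis b
    have : FiniteDimensional K W := b.finiteDimensional_of_finite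
    -- The induction hypothesis applies to every hyperplane of `W`.
    have hyper : ∀ ξ : Module.Dual K W, ξ ≠ 0 → ∃ (x₀ : W) (_ : ξ x₀ = 1)
        (b' : Basis (Fin d) K (LinearMap.ker ξ)),
        (∀ m, (∀ x ∈ LinearMap.ker ξ, ρ x m = 0) →
          m ∈ LinearMap.range (opProd ρ (Subtype.val ∘ ⇑b'))) ∧
        ∀ D : LinearMap.ker ξ →ₗ[K] M, (∀ x, ρ x.1 (D x) = 0) → ∃ m, ∀ x, D x = ρ x.1 m := by
      intro ξ hξ
      obtain ⟨x₀, hx₀⟩ := LinearMap.surjective hξ 1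
      have hd : finrank K (LinearMap.ker ξ) = d := by
        have := Module.Dual.finrank_ker_add_one_of_ne_zero hξ
        omega
      let b' := finBasisOfFinrankEq K (LinearMap.ker ξ) hd
      obtain ⟨h₁, h₂⟩ := ih (ρ.domRestrict (LinearMap.ker ξ)) (fun x => hρ x.1)
        (fun x hx => hex x.1 (by simpa using hx)) b'
      exact ⟨x₀, hx₀, b', fun m hm => h₁ m fun x => hm x.1 x.2, h₂⟩
    have inv : ∀ m, (∀ x, ρ x m = 0) → m ∈ LinearMap.range (opProd ρ b) := by
      -- A line is settled by exactness of its generator; the pencil below needs two independent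
      -- functionals.
      rcases Nat.eq_zero_or_pos d with rfl | hd
      · intro m hm
        have := hex (b 0) (b.ne_zero 0) (LinearMap.mem_ker.mpr (hm (b 0)))
        rw [opProd_succ]
        simpa using this
      let V : Submodule K M := ⨅ x, LinearMap.ker (ρ x)
      have memV : ∀ m, m ∈ V ↔ ∀ x, ρ x m = 0 := fun m => by simp [V]
      let B : Submodule K (W →ₗ[K] M) := LinearMap.range ρ.flip
      let A : Module.Dual K W →ₗ[K] V →ₗ[K] ((W →ₗ[K] M) ⧸ B) := LinearMap.mk₂ K
        (fun ξ m => B.mkQ (ξ.smulRight m.1))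
        (fun ξ ξ' m => by
          rw [← map_add]; congr 1; ext; simp [add_smul])
        (fun c ξ m => by
          rw [← map_smul]; congr 1; ext; simp [mul_smul])
        (fun ξ m m' => by
          rw [← map_add]; congr 1; ext; simp)
        (fun c ξ m => by
          rw [← map_smul]; congr 1; ext x; simp [smul_comm c])
      have hA : ∀ ξ m, A ξ m = 0 ↔ ∃ n, ∀ x, ξ x • m.1 = ρ x n := by
        intro ξ m
        change B.mkQ (ξ.smulRight m.1) = 0 ↔ _
        rw [Submodule.mkQ_apply, Submodule.Quotient.mk_eq_zero]
        refine exists_congr fun n => ?_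
        rw [eq_comm, LinearMap.ext_iff]
        rfl
      let R : Submodule K V := (LinearMap.range (opProd ρ b)).comap V.subtype
      have hker : ∀ ξ, ξ ≠ 0 → LinearMap.ker (A ξ) = R := by
        intro ξ hξ
        obtain ⟨x₀, hx₀, b', h₁, h₂⟩ := hyper ξ hξ
        ext m
        rw [LinearMap.mem_ker, hA]
        exact ⟨fun ⟨n, hn⟩ => mem_range_opProd_of_smul_eq ρ hρ ξ x₀ hx₀ b b' h₁ m n hn,
          fun hm => exists_smul_eq_of_mem_range_opProd ρ hρ ξ x₀ hx₀ b b' m hm⟩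
      let i₀ : Fin (d + 1) := 0
      let i₁ : Fin (d + 1) := ⟨1, by omega⟩
      have hi : i₀ ≠ i₁ := by simp [i₀, i₁, Fin.ext_iff]
      have hξ : b.coord i₀ ≠ 0 := fun h => by
        simpa using LinearMap.congr_fun h (b i₀)
      have hη : ∀ c : K, b.coord i₁ - c • b.coord i₀ ≠ 0 := fun c h => by
        have := LinearMap.congr_fun h (b i₁)
        simp [hi.symm] at this
      have hR : R = ⊤ := by
        refine eq_top_of_pencil (A (b.coord i₀)) (A (b.coord i₁)) R (hker _ hξ) ?_ ?_ ?_
        · refine (hker _ ?_).ge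
          simpa using hη 0
        -- Modulo coboundaries, every cocycle has the form `ξ ⊗ m'` for the fixed `ξ = b.coord i₀`;
        -- in particular so does the one attached to `b.coord i₁`.
        · rintro _ ⟨m, rfl⟩
          obtain ⟨x₀, hx₀, b', h₁, h₂⟩ := hyper _ hξ
          obtain ⟨m', n, hm', h⟩ := exists_eq_smul_add_of_cocycle ρ hρ _ x₀ hx₀ h₂
            ((b.coord i₁).smulRight m.1) (fun x => by
              rw [LinearMap.smulRight_apply, map_smul, (memV _).mp m.2, smul_zero])
          refine ⟨⟨m', (memV _).mpr hm'⟩, ?_⟩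
          change B.mkQ _ = B.mkQ _
          rw [Submodule.mkQ_apply, Submodule.mkQ_apply, Submodule.Quotient.eq]
          refine ⟨-n, LinearMap.ext fun x => ?_⟩
          have hx := h x
          rw [LinearMap.smulRight_apply] at hx
          rw [LinearMap.flip_apply, map_neg, LinearMap.sub_apply, LinearMap.smulRight_apply,
            LinearMap.smulRight_apply, hx, sub_add_cancel_left]
        · intro c
          rw [← map_smul, ← map_sub]
          exact (hker _ (hη c)).le
      intro m hm
      have : (⟨m, (memV m).mpr hm⟩ : V) ∈ R := hR ▸ Submodule.mem_top
      exact this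
    refine ⟨inv, fun D hD => ?_⟩
    -- A cocycle is `ξ ⊗ m` up to a coboundary, with `m` invariant. By the first half `m` is a top
    -- product, which makes `ξ ⊗ m` a coboundary too.
    have hξ : b.coord 0 ≠ 0 := fun h => by simpa using LinearMap.congr_fun h (b 0)
    obtain ⟨x₀, hx₀, b', h₁, h₂⟩ := hyper _ hξ
    obtain ⟨m, n, hm, h⟩ := exists_eq_smul_add_of_cocycle ρ hρ _ x₀ hx₀ h₂ D hD
    obtain ⟨n', hn'⟩ := exists_smul_eq_of_mem_range_opProd ρ hρ _ x₀ hx₀ b b' m (inv m hm)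
    exact ⟨n' + n, fun x => by rw [h, hn', map_add]⟩

variable {W : Type*} [AddCommGroup W] [Module K W] {d : ℕ}

theorem mem_range_opProd_of_forall_eq_zero [IsAlgClosed K] [FiniteDimensional K M]
    (ρ : W →ₗ[K] Module.End K M) (hρ : ∀ x, ρ x * ρ x = 0)
    (hex : ∀ x, x ≠ 0 → LinearMap.ker (ρ x) ≤ LinearMap.range (ρ x)) (b : Basis (Fin d) K W)
    (m : M) (hm : ∀ x, ρ x m = 0) : m ∈ LinearMap.range (opProd ρ b) :=
  (invariants_and_cocycles_of_exact d ρ hρ hex b).1 m hm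

/-- Transposition reverses the order of composition, whence `Fin.rev`. -/
theorem opProd_dualMap (ρ : W →ₗ[K] Module.End K M) (v : Fin d → W) :
    opProd ((Module.Dual.transpose (R := K)).comp ρ : W →ₗ[K] Module.End K (Module.Dual K M)) v =
      (opProd ρ (v ∘ Fin.rev)).dualMap := by
  have key : ∀ l : List (Module.End K M),
      (l.map fun f => (Module.Dual.transpose f : Module.End K (Module.Dual K M))).prod =
        l.reverse.prod.dualMap := by
    intro l
    induction l with
    | nil => rfl
    | cons f l ih =>
      rw [List.map_cons, List.prod_cons, ih, List.reverse_cons, List.prod_append]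
      rfl
  have h := key (List.ofFn fun i => ρ (v i))
  rw [List.map_ofFn] at h
  rw [opProd, opProd]
  refine h.trans ?_
  congr 2
  refine List.ext_getElem (by simp) fun i h₁ h₂ => ?_
  simp only [List.length_reverse, List.length_ofFn] at h₁
  simp only [List.getElem_reverse, List.getElem_ofFn, List.length_ofFn, Function.comp_apply]
  congr 2
  ext
  simp only [Fin.val_rev]
  omega

/-- If the top exterior power of `W` kills `m`, then `m ∈ W M`. -/
theorem mem_iSup_range_of_opProd_eq_zero [IsAlgClosed K] [FiniteDimensional K M]
    (ρ : W →ₗ[K] Module.End K M) (hρ : ∀ x, ρ x * ρ x = 0)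
    (hex : ∀ x, x ≠ 0 → LinearMap.ker (ρ x) ≤ LinearMap.range (ρ x)) (b : Basis (Fin d) K W)
    (m : M) (hm : opProd ρ b m = 0) : m ∈ ⨆ x, LinearMap.range (ρ x) := by
  by_contra hmem
  -- A functional `φ` vanishing on `W M` is an invariant of the dual module, where exactness
  -- persists. Hence `φ = ψ ∘ ω` with `ω` the top product, and `φ m = 0`. The reversed basis
  -- compensates for transposition.
  obtain ⟨φ, hφ, hφ0⟩ := Submodule.exists_le_ker_of_notMem hmem
  let ρ' : W →ₗ[K] Module.End K (Module.Dual K M) := (Module.Dual.transpose (R := K)).comp ρ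
  have hle : ∀ x, LinearMap.range (ρ x) ≤ LinearMap.ker (ρ x) := by
    rintro x _ ⟨n, rfl⟩
    exact LinearMap.congr_fun (hρ x) n
  have h := mem_range_opProd_of_forall_eq_zero ρ' (fun x => ?_) (fun x hx ψ hψ => ?_)
    (b.reindex Fin.revPerm) φ (fun x => ?_)
  · obtain ⟨ψ, rfl⟩ := h
    apply hφ
    have hb : (⇑(b.reindex Fin.revPerm) ∘ Fin.rev : Fin d → W) = b := by
      ext i
      simp
    rw [opProd_dualMap, hb, LinearMap.dualMap_apply, hm, map_zero]
  · ext ψ n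
    change ψ ((ρ x * ρ x) n) = 0
    rw [hρ, LinearMap.zero_apply, map_zero]
  · change ψ ∈ LinearMap.range (ρ x).dualMap
    rw [LinearMap.range_dualMap_eq_dualAnnihilator_ker, Submodule.mem_dualAnnihilator]
    intro n hn
    obtain ⟨n, rfl⟩ := hex x hx hn
    exact LinearMap.congr_fun (LinearMap.mem_ker.mp hψ) n
  · ext n
    exact LinearMap.mem_ker.mp (hφ0 (Submodule.mem_iSup_of_mem x ⟨n, rfl⟩))

end ExteriorRankVariety

/-! ### Derivations on top products, and the submodule generated by a vector over an exterior
algebra. -/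

section DerivationOfProducts

open Module

variable {K W N : Type*} [Field K] [AddCommGroup W] [Module K W] [AddCommGroup N] [Module K N]

/-- If `[A, ρ x] = ρ (T x)`, then `[A, -]` acts on operator products by the Leibniz rule. -/
theorem mul_opProd_eq_add_sum (ρ : W →ₗ[K] Module.End K N) (A : Module.End K N) (T : W → W)
    (hA : ∀ x, A * ρ x = ρ x * A + ρ (T x)) {k : ℕ} (v : Fin k → W) :
    A * opProd ρ v = opProd ρ v * A + ∑ i, opProd ρ (Function.update v i (T (v i))) := by
  induction k with
  | zero => simp
  | succ k ih =>
    have h₀ : ∀ w : W, opProd ρ (Function.update v 0 w) = ρ w * opProd ρ fun i => v i.succ := by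
      intro w
      rw [opProd_succ]
      simp
    have h₁ : ∀ (i : Fin k) (w : W), opProd ρ (Function.update v i.succ w) =
        ρ (v 0) * opProd ρ (Function.update (fun i => v i.succ) i w) := by
      intro i w
      rw [opProd_succ]
      congr 2
      funext j
      simp [Function.update_apply]
    rw [Fin.sum_univ_succ, h₀]
    simp only [h₁]
    rw [opProd_succ, ← mul_assoc, hA, add_mul, mul_assoc, ih, mul_add, ← Finset.mul_sum]
    noncomm_ring

/-- The scalar by which a linear operator acts on the top exterior power. -/
noncomputable def topCharacter {d : ℕ} (b : Basis (Fin d) K W) (T : W → W) : K :=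
  ∑ i, b.det (Function.update b i (T (b i)))

/-- The Leibniz rule, with each term a multiple of the top product because the top exterior power is
one-dimensional. -/
theorem mul_opProd_basis (ρ : W →ₗ[K] Module.End K N) (hρ : ∀ x, ρ x * ρ x = 0)
    (A : Module.End K N) (T : W → W) (hA : ∀ x, A * ρ x = ρ x * A + ρ (T x)) {d : ℕ}
    (b : Basis (Fin d) K W) :
    A * opProd ρ b = opProd ρ b * A + topCharacter b T • opProd ρ b := by
  rw [mul_opProd_eq_add_sum ρ A T hA, topCharacter, Finset.sum_smul]
  congr 1
  exact Finset.sum_congr rfl fun i _ => opProd_eq_det_smul ρ hρ b _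

theorem topCharacter_reindex {d : ℕ} (b : Basis (Fin d) K W) (σ : Equiv.Perm (Fin d))
    (T : W → W) : topCharacter (b.reindex σ) T = topCharacter b T := by
  unfold topCharacter
  rw [← Equiv.sum_comp σ]
  refine Finset.sum_congr rfl fun i _ => ?_
  rw [Basis.det_reindex]
  congr 1
  funext j
  simp [Function.update_apply]

/-- If `x_j P_k v = 0` for `j ≠ k` and `u` is a combination of products of `d` vectors applied to
`v` that is killed by `W`, `dim W = d + 1`, then `u = 0` unless the top product kills `v`. -/
theorem eq_zero_of_mem_span_opProd (ρ : W →ₗ[K] Module.End K N) (hρ : ∀ x, ρ x * ρ x = 0) {d : ℕ}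
    (b : Basis (Fin (d + 1)) K W) (u v : N)
    (hu : u ∈ Submodule.span K (Set.range fun w : Fin d → W => opProd ρ w v))
    (hW : ∀ x, ρ x u = 0) (hv : opProd ρ b v ≠ 0) : u = 0 := by
  -- `P k` omits the `k`-th basis vector; these products span the part of degree `d`.
  let P : Fin (d + 1) → N := fun k => opProd ρ (⇑b ∘ k.succAbove) v
  obtain ⟨f, hf⟩ := exists_alternatingMap_eq_opProd ρ hρ d
  obtain ⟨f', hf'⟩ := exists_alternatingMap_eq_opProd ρ hρ (d + 1)
  have hspan : Submodule.span K (Set.range fun w : Fin d → W => opProd ρ w v) ≤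
      Submodule.span K (Set.range P) := by
    rw [Submodule.span_le]
    rintro _ ⟨w, rfl⟩
    let S := Submodule.span K (Set.range P)
    let F : W [⋀^Fin d]→ₗ[K] (N ⧸ S) :=
      (S.mkQ ∘ₗ LinearMap.applyₗ v).compAlternatingMap f
    have hF : F = 0 := by
      refine b.ext_alternating fun c hc => ?_
      change S.mkQ (f (fun i => b (c i)) v) = 0
      rw [Submodule.mkQ_apply, Submodule.Quotient.mk_eq_zero]
      obtain ⟨k, hk⟩ : ∃ k, ∀ i, c i ≠ k := by
        by_contra! h
        have := Fintype.card_le_of_surjective c h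
        simp at this
      choose τ hτ using fun i => Fin.exists_succAbove_eq (hk i)
      have hτi : Function.Injective τ := fun i j hij => hc (by rw [← hτ, ← hτ, hij])
      let σ : Equiv.Perm (Fin d) := Equiv.ofBijective τ (Finite.injective_iff_bijective.mp hτi)
      have h₁ : (fun i => b (c i)) = (⇑b ∘ k.succAbove) ∘ ⇑σ := by
        funext i
        simp [σ, hτ]
      rw [h₁, f.map_perm, hf]
      rcases Int.units_eq_one_or (Equiv.Perm.sign σ) with h | h
      · rw [h, one_smul]
        exact Submodule.subset_span ⟨k, rfl⟩
      · rw [h, Units.neg_smul, one_smul, LinearMap.neg_apply]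
        exact S.neg_mem (Submodule.subset_span ⟨k, rfl⟩)
    have := DFunLike.congr_fun hF w
    change S.mkQ (f w v) = 0 at this
    rw [Submodule.mkQ_apply, Submodule.Quotient.mk_eq_zero, hf] at this
    exact this
  obtain ⟨β, rfl⟩ := (Submodule.mem_span_range_iff_exists_fun K).mp (hspan hu)
  have hne : ∀ j k, j ≠ k → ρ (b j) (P k) = 0 := by
    intro j k hjk
    change (ρ (b j) * opProd ρ (⇑b ∘ k.succAbove)) v = 0
    rw [← opProd_cons, opProd_eq_zero_of_not_injective ρ hρ, LinearMap.zero_apply]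
    intro h
    obtain ⟨i, hi⟩ := Fin.exists_succAbove_eq hjk
    have := h (a₁ := 0) (a₂ := i.succ) (by simp [hi])
    exact Fin.succ_ne_zero i this.symm
  have heq : ∀ j, ρ (b j) (P j) ≠ 0 := by
    intro j
    change (ρ (b j) * opProd ρ (⇑b ∘ j.succAbove)) v ≠ 0
    have hinj : Function.Injective (Fin.cons j j.succAbove : Fin (d + 1) → Fin (d + 1)) := by
      rw [Fin.cons_injective_iff]
      exact ⟨by simp, Fin.succAbove_right_injective⟩
    let σ : Equiv.Perm (Fin (d + 1)) :=
      Equiv.ofBijective _ (Finite.injective_iff_bijective.mp hinj)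
    have h₁ : (Fin.cons (b j) (⇑b ∘ j.succAbove) : Fin (d + 1) → W) = ⇑b ∘ ⇑σ := by
      funext i
      refine Fin.cases ?_ (fun i => ?_) i <;> simp [σ]
    rw [← opProd_cons, h₁, ← hf', f'.map_perm, hf']
    rcases Int.units_eq_one_or (Equiv.Perm.sign σ) with h | h <;> simp [h, hv]
  -- Applying `b j` to the combination isolates `β j`, since `b j` times `P j` is the top product on
  -- `v` up to sign.
  have hβ : ∀ j, β j = 0 := by
    intro j
    have h := hW (b j)
    rw [map_sum, Finset.sum_eq_single j, map_smul] at h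
    · exact (smul_eq_zero.mp h).resolve_right (heq j)
    · intro k _ hk
      rw [map_smul, hne j k hk.symm, smul_zero]
    · simp
  simp [hβ]

end DerivationOfProducts

/-! ### Operator actions of the superalgebra and invariance of the double top product. -/

namespace LieSuperalgebra

open Module

variable {g : LieSuperalgebra.{u}}

/-- A representation of `g` on a vector space `N` without grading: operators attached to the
elements of `g₀` and `g₁` satisfying the defining relations. -/
structure OperatorAction (g : LieSuperalgebra.{u}) (N : Type*) [AddCommGroup N] [Module ℂ N] where
  ev : g.even →ₗ[ℂ] Module.End ℂ N
  od : g.odd →ₗ[ℂ] Module.End ℂ N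
  ev_mul_ev : ∀ a a', ev a * ev a' = ev a' * ev a + ev ⁅a, a'⁆
  ev_mul_od : ∀ a x, ev a * od x = od x * ev a + od ⁅a, x⁆
  od_mul_od : ∀ x y, od x * od y = ev (g.bracket x y) - od y * od x

/-- A `g₀`-stable subspace of `g₁` with zero bracket. -/
structure IsAbelianStable (W : Submodule ℂ g.odd) : Prop where
  bracket_eq_zero : ∀ x ∈ W, ∀ y ∈ W, g.bracket x y = 0
  lie_mem : ∀ (a : g.even), ∀ x ∈ W, ⁅a, x⁆ ∈ W

namespace IsAbelianStable

variable {W : Submodule ℂ g.odd} (hW : IsAbelianStable W)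

/-- The character by which `g₀` acts on the top exterior power of `W`. -/
noncomputable def character {d : ℕ} (b : Basis (Fin d) ℂ W) (a : g.even) : ℂ :=
  topCharacter b fun x => ⟨⁅a, x.1⁆, hW.lie_mem a x.1 x.2⟩

end IsAbelianStable

namespace OperatorAction

variable {N : Type*} [AddCommGroup N] [Module ℂ N] (R : OperatorAction g N)

/-- The operators attached to the elements of a subspace of `g₁`. -/
abbrev odOn (W : Submodule ℂ g.odd) : W →ₗ[ℂ] Module.End ℂ N := R.od.domRestrict W

variable {W : Submodule ℂ g.odd} (hW : IsAbelianStable W)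

include hW in
theorem odOn_mul_self (x : W) : R.odOn W x * R.odOn W x = 0 := by
  have h := R.od_mul_od x.1 x.1
  rw [hW.bracket_eq_zero _ x.2 _ x.2, map_zero, zero_sub] at h
  have h₂ : (2 : ℂ) • (R.od x.1 * R.od x.1) = 0 := by
    rw [two_smul]
    nth_rewrite 1 [h]
    exact neg_add_cancel _
  exact (smul_eq_zero.mp h₂).resolve_left two_ne_zero

theorem ev_mul_odOn (a : g.even) (x : W) : R.ev a * R.odOn W x =
    R.odOn W x * R.ev a + R.odOn W ⟨⁅a, x.1⁆, hW.lie_mem a x.1 x.2⟩ :=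
  R.ev_mul_od a x.1

theorem ev_mul_opProd {d : ℕ} (b : Basis (Fin d) ℂ W) (a : g.even) :
    R.ev a * opProd (R.odOn W) b =
      opProd (R.odOn W) b * R.ev a + hW.character b a • opProd (R.odOn W) b :=
  mul_opProd_basis _ (R.odOn_mul_self hW) (R.ev a) _ (R.ev_mul_odOn hW a) b

include hW in
/-- If `y` kills `v` and `g₀` acts on `v` by scalars, then `y` lowers the degree of `Λ(W) v`. -/
theorem od_opProd_mem_span (y : g.odd) (v : N) (hy : R.od y v = 0) (χ : g.even → ℂ)
    (hχ : ∀ a, R.ev a v = χ a • v) (k : ℕ) (w : Fin (k + 1) → W) :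
    R.od y (opProd (R.odOn W) w v) ∈
      Submodule.span ℂ (Set.range fun w : Fin k → W => opProd (R.odOn W) w v) := by
  have hev : ∀ (k : ℕ) (a : g.even) (w : Fin k → W), R.ev a (opProd (R.odOn W) w v) ∈
      Submodule.span ℂ (Set.range fun w : Fin k → W => opProd (R.odOn W) w v) := by
    intro k a w
    rw [← Module.End.mul_apply, mul_opProd_eq_add_sum _ _ _ (R.ev_mul_odOn hW a),
      LinearMap.add_apply, Module.End.mul_apply, hχ, map_smul, LinearMap.sum_apply]
    exact add_mem (Submodule.smul_mem _ _ (Submodule.subset_span ⟨w, rfl⟩))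
      (sum_mem fun i _ => Submodule.subset_span ⟨_, rfl⟩)
  -- Moving `y` past the first factor costs an even operator, which preserves the degree of what
  -- follows.
  have step : ∀ (k : ℕ) (w : Fin (k + 1) → W), R.od y (opProd (R.odOn W) w v) =
      R.ev (g.bracket y (w 0)) (opProd (R.odOn W) (fun i => w i.succ) v) -
        R.odOn W (w 0) (R.od y (opProd (R.odOn W) (fun i => w i.succ) v)) := by
    intro k w
    rw [opProd_succ, Module.End.mul_apply, LinearMap.domRestrict_apply, ← Module.End.mul_apply,
      R.od_mul_od, LinearMap.sub_apply, Module.End.mul_apply]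
  induction k with
  | zero =>
    rw [step]
    refine sub_mem (hev _ _ _) ?_
    rw [opProd_zero, Module.End.one_apply, hy, map_zero]
    exact zero_mem _
  | succ k ih =>
    rw [step]
    refine sub_mem (hev _ _ _) ?_
    have h := ih fun i => w i.succ
    generalize R.od y (opProd (R.odOn W) (fun i => w i.succ) v) = u at h
    induction h using Submodule.span_induction with
    | mem u hu =>
      obtain ⟨w', rfl⟩ := hu
      refine Submodule.subset_span ⟨Fin.cons (w 0) w', ?_⟩
      dsimp only
      rw [opProd_cons]
      rfl
    | zero => rw [map_zero]; exact zero_mem _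
    | add u u' _ _ h h' => rw [map_add]; exact add_mem h h'
    | smul c u _ h => rw [map_smul]; exact Submodule.smul_mem _ _ h

variable {W' : Submodule ℂ g.odd} (hW' : IsAbelianStable W')

/-- The relative trace: if `g₁ = W + W'` with `W`, `W'` abelian, and `n` transforms under `g₀` by
the inverse of the character of `Λᵗᵒᵖ W ⊗ Λᵗᵒᵖ W'`, then the product of bases of `W` and
`W'` applied to `n` is invariant. -/
theorem opProd_opProd_invariant (hsup : W ⊔ W' = ⊤) {d d' : ℕ} (b : Basis (Fin d) ℂ W)
    (b' : Basis (Fin d') ℂ W') (n : N)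
    (hn : ∀ a, R.ev a n = -(hW.character b a + hW'.character b' a) • n) :
    (∀ a, R.ev a (opProd (R.odOn W) b (opProd (R.odOn W') b' n)) = 0) ∧
      ∀ x, R.od x (opProd (R.odOn W) b (opProd (R.odOn W') b' n)) = 0 := by
  set v := opProd (R.odOn W') b' n with hv
  have hva : ∀ a, R.ev a v = -hW.character b a • v := by
    intro a
    have h := LinearMap.congr_fun (R.ev_mul_opProd hW' b' a) n
    rw [Module.End.mul_apply, LinearMap.add_apply, Module.End.mul_apply, hn, map_smul,
      LinearMap.smul_apply, ← hv] at h
    rw [h]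
    module
  have hvy : ∀ y ∈ W', R.od y v = 0 := fun y hy =>
    LinearMap.congr_fun (mul_opProd_basis_eq_zero (R.odOn W') (R.odOn_mul_self hW') b' ⟨y, hy⟩) n
  have hs : ∀ a, R.ev a (opProd (R.odOn W) b v) = 0 := by
    intro a
    have h := LinearMap.congr_fun (R.ev_mul_opProd hW b a) v
    rw [Module.End.mul_apply, LinearMap.add_apply, Module.End.mul_apply, hva, map_smul,
      LinearMap.smul_apply] at h
    rw [h]
    module
  have hx : ∀ x ∈ W, R.od x (opProd (R.odOn W) b v) = 0 := fun x hx =>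
    LinearMap.congr_fun (mul_opProd_basis_eq_zero (R.odOn W) (R.odOn_mul_self hW) b ⟨x, hx⟩) v
  -- Let `u` be the double product. By `od_opProd_mem_span`, `y u` has degree one below the top. It
  -- is killed by `W`, because `x y u = [x, y] u - y x u` and both terms vanish. By
  -- `eq_zero_of_mem_span_opProd` it is zero.
  have hy : ∀ y ∈ W', R.od y (opProd (R.odOn W) b v) = 0 := by
    intro y hy
    by_cases h0 : opProd (R.odOn W) b v = 0
    · rw [h0, map_zero]
    cases d with
    | zero => rw [opProd_zero, Module.End.one_apply]; exact hvy y hy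
    | succ d =>
      refine eq_zero_of_mem_span_opProd (R.odOn W) (R.odOn_mul_self hW) b _ v
        (R.od_opProd_mem_span hW y v (hvy y hy) _ hva d b) (fun x => ?_) h0
      rw [LinearMap.domRestrict_apply, ← Module.End.mul_apply, R.od_mul_od,
        LinearMap.sub_apply, hs, Module.End.mul_apply, hx x.1 x.2, map_zero, sub_zero]
  refine ⟨hs, fun x => ?_⟩
  obtain ⟨y, hy', z, hz, rfl⟩ := Submodule.mem_sup.mp (hsup ▸ Submodule.mem_top : x ∈ W ⊔ W')
  rw [map_add, LinearMap.add_apply, hx y hy', hy z hz, add_zero]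

end OperatorAction

end LieSuperalgebra

/-! ### Actions with parity, supercommutators on linear maps, and the relative trace. -/

namespace LieSuperalgebra

open Module

variable {g : LieSuperalgebra.{u}}

/-- The operators of `g₀` and `g₁` on the total space of a `g`-module, with the parity operator. -/
structure SuperAction (g : LieSuperalgebra.{u}) (V : Type*) [AddCommGroup V] [Module ℂ V] extends
    OperatorAction g V where
  par : Module.End ℂ V
  par_mul_par : par * par = 1
  par_mul_ev : ∀ a, par * ev a = ev a * par
  par_mul_od : ∀ x, par * od x = -(od x * par)

namespace SuperAction

variable {V E X : Type*} [AddCommGroup V] [Module ℂ V] [AddCommGroup E] [Module ℂ E]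
  [AddCommGroup X] [Module ℂ X]

/-- Complete reducibility over `g₀` for homogeneous subspaces. -/
def IsSemisimple (R : SuperAction g V) : Prop :=
  ∀ S : Submodule ℂ V, (∀ a, ∀ v ∈ S, R.ev a v ∈ S) → (∀ v ∈ S, R.par v ∈ S) →
    ∃ T : Submodule ℂ V, (∀ a, ∀ v ∈ T, R.ev a v ∈ T) ∧ IsCompl S T

/-- Parity-preserving `g`-homomorphisms. -/
structure IsHom (R : SuperAction g V) (R' : SuperAction g E) (f : V →ₗ[ℂ] E) : Prop where
  map_ev : ∀ a v, f (R.ev a v) = R'.ev a (f v)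
  map_od : ∀ x v, f (R.od x v) = R'.od x (f v)
  map_par : ∀ v, f (R.par v) = R'.par (f v)

section Basic

variable (R : SuperAction g V) (R' : SuperAction g E)

@[simp]
theorem par_par (v : V) : R.par (R.par v) = v := LinearMap.congr_fun R.par_mul_par v

theorem par_ev (a : g.even) (v : V) : R.par (R.ev a v) = R.ev a (R.par v) :=
  LinearMap.congr_fun (R.par_mul_ev a) v

theorem par_od (x : g.odd) (v : V) : R.par (R.od x v) = -R.od x (R.par v) :=
  LinearMap.congr_fun (R.par_mul_od x) v

theorem ev_ev (a a' : g.even) (v : V) :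
    R.ev a (R.ev a' v) = R.ev a' (R.ev a v) + R.ev ⁅a, a'⁆ v :=
  LinearMap.congr_fun (R.ev_mul_ev a a') v

theorem ev_od (a : g.even) (x : g.odd) (v : V) :
    R.ev a (R.od x v) = R.od x (R.ev a v) + R.od ⁅a, x⁆ v :=
  LinearMap.congr_fun (R.ev_mul_od a x) v

theorem od_od (x y : g.odd) (v : V) :
    R.od x (R.od y v) = R.ev (g.bracket x y) v - R.od y (R.od x v) :=
  LinearMap.congr_fun (R.od_mul_od x y) v

theorem par_opProd {W : Submodule ℂ g.odd} {k : ℕ} (w : Fin k → W) (v : V) :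
    R.par (opProd (R.odOn W) w v) = (-1 : ℂ) ^ k • opProd (R.odOn W) w (R.par v) := by
  induction k with
  | zero => simp
  | succ k ih =>
    rw [opProd_succ, Module.End.mul_apply, LinearMap.domRestrict_apply, par_od, ih, map_smul,
      pow_succ, Module.End.mul_apply]
    module

/-- The action on linear maps by (super)commutators. -/
def homAction : OperatorAction g (V →ₗ[ℂ] E) where
  ev := LinearMap.mk₂ ℂ (fun a t => R'.ev a ∘ₗ t - t ∘ₗ R.ev a)
    (fun a a' t => by ext; simp; abel) (fun c a t => by ext; simp [smul_sub])
    (fun a t t' => by ext; simp; abel) (fun c a t => by ext; simp [smul_sub])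
  -- Conjugation by parity supplies the sign `(-1)^|t|`, so the formula covers inhomogeneous `t`.
  od := LinearMap.mk₂ ℂ (fun x t => R'.od x ∘ₗ t - R'.par ∘ₗ t ∘ₗ R.par ∘ₗ R.od x)
    (fun a a' t => by ext; simp; abel) (fun c a t => by ext; simp [smul_sub])
    (fun a t t' => by ext; simp; abel) (fun c a t => by ext; simp [smul_sub])
  ev_mul_ev a a' := by
    ext t v
    simp only [Module.End.mul_apply, LinearMap.mk₂_apply, LinearMap.sub_apply,
      LinearMap.comp_apply, LinearMap.add_apply, map_sub]
    rw [ev_ev R' a a' (t v), ev_ev R a a' v, map_add]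
    abel
  ev_mul_od a x := by
    ext t v
    simp only [Module.End.mul_apply, LinearMap.mk₂_apply, LinearMap.sub_apply,
      LinearMap.comp_apply, LinearMap.add_apply, map_sub]
    have h : R.od x (R.ev a v) = R.ev a (R.od x v) - R.od ⁅a, x⁆ v := by
      rw [ev_od, add_sub_cancel_right]
    simp only [h, map_sub, ev_od R', par_ev]
    abel
  od_mul_od x y := by
    ext t v
    simp only [Module.End.mul_apply, LinearMap.mk₂_apply, LinearMap.sub_apply,
      LinearMap.comp_apply, map_sub, par_od, par_par, map_neg]
    rw [od_od R' x y (t v), od_od R x y v]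
    simp only [map_sub]
    abel

theorem homAction_ev_apply (a : g.even) (t : V →ₗ[ℂ] E) (v : V) :
    (homAction R R').ev a t v = R'.ev a (t v) - t (R.ev a v) := rfl

theorem homAction_od_apply (x : g.odd) (t : V →ₗ[ℂ] E) (v : V) :
    (homAction R R').od x t v = R'.od x (t v) - R'.par (t (R.par (R.od x v))) := rfl

theorem homAction_opProd_comp (R'' : SuperAction g X) (p : E →ₗ[ℂ] X) (hp : IsHom R' R'' p)
    {W : Submodule ℂ g.odd} {k : ℕ} (w : Fin k → W) (t : V →ₗ[ℂ] E) :
    opProd ((homAction R R'').odOn W) w (p ∘ₗ t) =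
      p ∘ₗ opProd ((homAction R R').odOn W) w t := by
  induction k with
  | zero => simp
  | succ k ih =>
    rw [opProd_succ, opProd_succ, Module.End.mul_apply, Module.End.mul_apply, ih]
    ext v
    simp only [LinearMap.domRestrict_apply, homAction_od_apply, LinearMap.comp_apply, map_sub,
      hp.map_od, hp.map_par]

/-- On a vector killed by `W`, the action of products from `W` on linear maps is by
postcomposition. -/
theorem homAction_opProd_apply_of_killed {W : Submodule ℂ g.odd} {k : ℕ} (w : Fin k → W)
    (t : V →ₗ[ℂ] E) (v : V) (hv : ∀ x ∈ W, R.od x v = 0) :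
    opProd ((homAction R R').odOn W) w t v = opProd (R'.odOn W) w (t v) := by
  induction k with
  | zero => simp
  | succ k ih =>
    rw [opProd_succ, opProd_succ, Module.End.mul_apply, Module.End.mul_apply,
      LinearMap.domRestrict_apply, homAction_od_apply, ih, hv _ (w 0).2]
    simp

end Basic

section Semisimple

variable {R : SuperAction g V} {R' : SuperAction g E}

theorem IsSemisimple.exists_projection (hR : R.IsSemisimple) (S : Submodule ℂ V)
    (hS : ∀ a, ∀ v ∈ S, R.ev a v ∈ S) (hS' : ∀ v ∈ S, R.par v ∈ S) :
    ∃ P : Module.End ℂ V, (∀ a v, P (R.ev a v) = R.ev a (P v)) ∧ (∀ v ∈ S, P v = v) ∧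
      ∀ v, P v ∈ S := by
  obtain ⟨T, hT, hST⟩ := hR S hS hS'
  let P : Module.End ℂ V := S.subtype ∘ₗ S.projectionOnto T hST
  have hPS : ∀ v ∈ S, P v = v := fun v hv => by
    simpa [P] using congrArg Subtype.val (Submodule.projectionOnto_apply_left hST ⟨v, hv⟩)
  have hPT : ∀ v ∈ T, P v = 0 := fun v hv => by
    simpa [P] using Submodule.projectionOnto_apply_right hST ⟨v, hv⟩
  refine ⟨P, fun a v => ?_, hPS, fun v => (S.projectionOnto T hST v).2⟩
  obtain ⟨s, hs, t, ht, rfl⟩ := Submodule.mem_sup.mp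
    (hST.sup_eq_top ▸ Submodule.mem_top : v ∈ S ⊔ T)
  simp only [map_add]
  rw [hPS s hs, hPT t ht, hPS _ (hS a s hs), hPT _ (hT a t ht), map_zero]

/-- Semi-equivariant linear maps between semisimple modules have semi-equivariant generalized
inverses. -/
theorem exists_generalized_inverse (hR : R.IsSemisimple) (hR' : R'.IsSemisimple)
    (Z : V →ₗ[ℂ] E) (χ : g.even → ℂ)
    (hZ : ∀ a v, R'.ev a (Z v) = Z (R.ev a v) + χ a • Z v) (ε : ℂ)
    (hpar : ∀ v, R'.par (Z v) = ε • Z (R.par v)) :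
    ∃ t : E →ₗ[ℂ] V, (∀ v, Z (t (Z v)) = Z v) ∧
      ∀ a e, R.ev a (t e) = t (R'.ev a e) - χ a • t e := by
  obtain ⟨P, hP, hPS, hPm⟩ := hR.exists_projection (LinearMap.ker Z)
    (fun a v hv => by
      have h := hZ a v
      rw [LinearMap.mem_ker.mp hv, map_zero, smul_zero, add_zero] at h
      exact h.symm)
    (fun v hv => by
      have h := hpar (R.par v)
      rw [par_par, LinearMap.mem_ker.mp hv, smul_zero] at h
      have h' := congrArg R'.par h
      rw [par_par, map_zero] at h'
      exact h')
  obtain ⟨Q, hQ, hQS, hQm⟩ := hR'.exists_projection (LinearMap.range Z)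
    (by
      rintro a _ ⟨v, rfl⟩
      exact ⟨R.ev a v + χ a • v, by rw [hZ, map_add, map_smul]⟩)
    (by
      rintro _ ⟨v, rfl⟩
      exact ⟨ε • R.par v, by rw [hpar, map_smul]⟩)
  obtain ⟨s, hs⟩ := Z.rangeRestrict.exists_rightInverse_of_surjective Z.range_rangeRestrict
  -- Project to the range of `Z`, lift by an arbitrary linear section, then remove the kernel
  -- component. The factor `1 - P` makes the result independent of the section, hence equivariant up
  -- to `χ`.
  let t : E →ₗ[ℂ] V := (1 - P) ∘ₗ s ∘ₗ Q.codRestrict (LinearMap.range Z) hQm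
  have ht : ∀ e v, Q e = Z v → t e = v - P v := by
    intro e v h
    have h₁ : Z (s (Q.codRestrict (LinearMap.range Z) hQm e)) = Z v :=
      (congrArg Subtype.val (LinearMap.congr_fun hs _)).trans h
    have h₂ : s (Q.codRestrict (LinearMap.range Z) hQm e) - v ∈ LinearMap.ker Z := by
      rw [LinearMap.mem_ker, map_sub, h₁, sub_self]
    have h₃ := hPS _ h₂
    rw [map_sub] at h₃
    change s _ - P (s _) = _
    rw [sub_eq_sub_iff_sub_eq_sub, ← h₃]
  have hZP : ∀ v, Z (P v) = 0 := fun v => hPm v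
  refine ⟨t, fun v => ?_, fun a e => ?_⟩
  · rw [ht (Z v) v (hQS _ ⟨v, rfl⟩), map_sub, hZP, sub_zero]
  · obtain ⟨v, hv⟩ := hQm e
    have h : Q (R'.ev a e) = Z (R.ev a v + χ a • v) := by
      rw [hQ, ← hv, hZ, map_add, map_smul]
    rw [ht e v hv.symm, ht _ _ h]
    simp only [map_sub, map_add, map_smul, hP, smul_sub]
    abel

/-- Surjective homomorphisms from a semisimple module split over `g₀`. -/
theorem exists_section (hR : R.IsSemisimple) (hR' : R'.IsSemisimple) (p : V →ₗ[ℂ] E)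
    (hp : IsHom R R' p) (hsurj : Function.Surjective p) :
    ∃ r : E →ₗ[ℂ] V, (∀ e, p (r e) = e) ∧ ∀ a e, R.ev a (r e) = r (R'.ev a e) := by
  obtain ⟨r, hr, hr'⟩ := exists_generalized_inverse hR hR' p 0
    (fun a v => by simp [hp.map_ev]) 1 (fun v => by simp [hp.map_par])
  refine ⟨r, fun e => ?_, fun a e => by simpa using hr' a e⟩
  obtain ⟨v, rfl⟩ := hsurj e
  exact hr v

end Semisimple

section Trace

variable (R : SuperAction g V) (R' : SuperAction g E)
variable {W W' : Submodule ℂ g.odd} (hW : IsAbelianStable W) (hW' : IsAbelianStable W')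
  (hsup : W ⊔ W' = ⊤) {d d' : ℕ} (b : Basis (Fin d) ℂ W) (b' : Basis (Fin d') ℂ W')

/-- The relative trace of a linear map, made parity-preserving. -/
noncomputable def relTrace (t : V →ₗ[ℂ] E) : V →ₗ[ℂ] E :=
  opProd ((homAction R R').odOn W) b (opProd ((homAction R R').odOn W') b' t) +
    R'.par ∘ₗ opProd ((homAction R R').odOn W) b (opProd ((homAction R R').odOn W') b' t) ∘ₗ R.par

theorem comp_relTrace (R'' : SuperAction g X) (p : E →ₗ[ℂ] X) (hp : IsHom R' R'' p)
    (t : V →ₗ[ℂ] E) : p ∘ₗ relTrace R R' b b' t = relTrace R R'' b b' (p ∘ₗ t) := by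
  simp only [relTrace, homAction_opProd_comp R R' R'' p hp]
  ext v
  simp [hp.map_par]

include hsup

/-- The twist of `t` cancels the character of the double top product, so the product `s` is
invariant. For odd `x` this reads `x s = par s par x`; hence moving `x` across `s + par s par` only
exchanges the two summands. -/
theorem isHom_relTrace (t : V →ₗ[ℂ] E)
    (ht : ∀ a e, R'.ev a (t e) = t (R.ev a e) - (hW.character b a + hW'.character b' a) • t e) :
    IsHom R R' (relTrace R R' b b' t) := by
  obtain ⟨h₀, h₁⟩ := (homAction R R').opProd_opProd_invariant hW hW' hsup b b' t (fun a => by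
    ext v
    rw [homAction_ev_apply, ht, LinearMap.smul_apply]
    module)
  rw [relTrace]
  generalize opProd ((homAction R R').odOn W) b (opProd ((homAction R R').odOn W') b' t) = s
    at h₀ h₁
  have h₀' : ∀ a v, s (R.ev a v) = R'.ev a (s v) := fun a v => by
    have := LinearMap.congr_fun (h₀ a) v
    rw [homAction_ev_apply, LinearMap.zero_apply, sub_eq_zero] at this
    exact this.symm
  have h₁' : ∀ x v, R'.od x (s v) = R'.par (s (R.par (R.od x v))) := fun x v => by
    have := LinearMap.congr_fun (h₁ x) v
    rwa [homAction_od_apply, LinearMap.zero_apply, sub_eq_zero] at this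
  refine ⟨fun a v => ?_, fun x v => ?_, fun v => ?_⟩
  · simp only [LinearMap.add_apply, LinearMap.comp_apply, map_add, h₀', par_ev]
  · have h := h₁' x (R.par v)
    rw [par_od, par_par, map_neg, map_neg] at h
    simp only [LinearMap.add_apply, LinearMap.comp_apply, map_add, ← h₁']
    rw [← neg_eq_iff_eq_neg.mpr (par_od R' x (s (R.par v))), h, map_neg, par_par, neg_neg]
    abel
  · simp only [LinearMap.add_apply, LinearMap.comp_apply, map_add, par_par]
    abel

end Trace

/-! ### Endomorphisms that lift along surjections. -/

section Lift

variable {V : Type w} [AddCommGroup V] [Module ℂ V]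

/-- Endomorphisms `f` such that `q ∘ f` lifts along every surjection onto the target of `q`. -/
structure IsLiftable (R : SuperAction g V) (f : Module.End ℂ V) : Prop where
  isHom : IsHom R R f
  exists_lift : ∀ {E X : Type w} [AddCommGroup E] [Module ℂ E] [AddCommGroup X] [Module ℂ X]
    (R' : SuperAction g E) (R'' : SuperAction g X), R'.IsSemisimple → R''.IsSemisimple →
    ∀ (p : E →ₗ[ℂ] X) (q : V →ₗ[ℂ] X), IsHom R' R'' p → Function.Surjective p → IsHom R R'' q →
      ∃ s : V →ₗ[ℂ] E, IsHom R R' s ∧ p ∘ₗ s = q ∘ₗ f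

variable {R : SuperAction g V}

theorem IsHom.comp {V E X : Type*} [AddCommGroup V] [Module ℂ V] [AddCommGroup E] [Module ℂ E]
    [AddCommGroup X] [Module ℂ X] {R : SuperAction g V} {R' : SuperAction g E}
    {R'' : SuperAction g X} {f : E →ₗ[ℂ] X} {f' : V →ₗ[ℂ] E} (hf : IsHom R' R'' f)
    (hf' : IsHom R R' f') : IsHom R R'' (f ∘ₗ f') :=
  ⟨fun a v => by simp [hf'.map_ev, hf.map_ev], fun a v => by simp [hf'.map_od, hf.map_od],
    fun v => by simp [hf'.map_par, hf.map_par]⟩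

theorem IsHom.add {V E : Type*} [AddCommGroup V] [Module ℂ V] [AddCommGroup E] [Module ℂ E]
    {R : SuperAction g V} {R' : SuperAction g E} {f f' : V →ₗ[ℂ] E} (hf : IsHom R R' f)
    (hf' : IsHom R R' f') : IsHom R R' (f + f') :=
  ⟨fun a v => by simp [hf'.map_ev, hf.map_ev], fun a v => by simp [hf'.map_od, hf.map_od],
    fun v => by simp [hf'.map_par, hf.map_par]⟩

theorem IsLiftable.mul_left {f f' : Module.End ℂ V} (hf : IsLiftable R f) (hf' : IsHom R R f') :
    IsLiftable R (f' * f) :=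
  ⟨hf'.comp hf.isHom, fun R' R'' h h' p q hp hp' hq =>
    hf.exists_lift R' R'' h h' p (q ∘ₗ f') hp hp' (hq.comp hf')⟩

theorem IsLiftable.mul_right {f f' : Module.End ℂ V} (hf : IsLiftable R f) (hf' : IsHom R R f') :
    IsLiftable R (f * f') := by
  refine ⟨hf.isHom.comp hf', fun R' R'' h h' p q hp hp' hq => ?_⟩
  obtain ⟨s, hs, hs'⟩ := hf.exists_lift R' R'' h h' p q hp hp' hq
  exact ⟨s ∘ₗ f', hs.comp hf', by rw [← LinearMap.comp_assoc, hs']; rfl⟩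

theorem IsLiftable.add {f f' : Module.End ℂ V} (hf : IsLiftable R f) (hf' : IsLiftable R f') :
    IsLiftable R (f + f') := by
  refine ⟨hf.isHom.add hf'.isHom, fun R' R'' h h' p q hp hp' hq => ?_⟩
  obtain ⟨s, hs, hps⟩ := hf.exists_lift R' R'' h h' p q hp hp' hq
  obtain ⟨s', hs', hps'⟩ := hf'.exists_lift R' R'' h h' p q hp hp' hq
  exact ⟨s + s', hs.add hs', by rw [LinearMap.comp_add, LinearMap.comp_add, hps, hps']⟩

theorem isLiftable_zero : IsLiftable R 0 :=
  ⟨⟨fun a v => by simp, fun x v => by simp, fun v => by simp⟩,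
    fun _ _ _ _ _ _ _ _ _ => ⟨0, ⟨fun a v => by simp, fun x v => by simp, fun v => by simp⟩,
      by simp⟩⟩

/-- With `r` a splitting of `p` over the even part, the lift is the trace of `r q t`: composition
with homomorphisms passes through the trace, so `p Tr(r q t) = Tr(q t) = q Tr(t)`. -/
theorem isLiftable_relTrace {W W' : Submodule ℂ g.odd} (hW : IsAbelianStable W)
    (hW' : IsAbelianStable W') (hsup : W ⊔ W' = ⊤) {d d' : ℕ} (b : Basis (Fin d) ℂ W)
    (b' : Basis (Fin d') ℂ W') (t : Module.End ℂ V)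
    (ht : ∀ a e, R.ev a (t e) = t (R.ev a e) - (hW.character b a + hW'.character b' a) • t e) :
    IsLiftable R (relTrace R R b b' t) := by
  refine ⟨isHom_relTrace R R hW hW' hsup b b' t ht, fun R' R'' h h' p q hp hp' hq => ?_⟩
  obtain ⟨r, hr, hr'⟩ := exists_section h h' p hp hp'
  refine ⟨relTrace R R' b b' (r ∘ₗ q ∘ₗ t), isHom_relTrace R R' hW hW' hsup b b' _ ?_, ?_⟩
  · intro a v
    simp only [LinearMap.comp_apply]
    rw [hr', ← hq.map_ev, ht, map_sub, map_sub, map_smul, map_smul]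
  · rw [comp_relTrace R R' b b' R'' p hp, comp_relTrace R R b b' R'' q hq]
    congr 1
    ext v
    simp [hr]

end Lift

end SuperAction

end LieSuperalgebra

/-! ### Fitting idempotents. -/

section Polynomials

open Polynomial

/-- An operator with a nonzero eigenvalue has a polynomial without constant term that is an
idempotent fixing the eigenvector. -/
theorem Module.End.exists_idempotent_aeval_mul {K V : Type*} [Field K] [AddCommGroup V]
    [Module K V] [FiniteDimensional K V] (F : Module.End K V) (η : K) (hη : η ≠ 0) (v : V)
    (hv : v ≠ 0) (hF : F v = η • v) :
    ∃ q : K[X], aeval F (q * X) * aeval F (q * X) = aeval F (q * X) ∧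
      aeval F (q * X) v = v := by
  have hp : minpoly K F ≠ 0 := minpoly.ne_zero (Algebra.IsIntegral.isIntegral F)
  obtain ⟨r, hr, hdvd⟩ := Polynomial.exists_eq_pow_rootMultiplicity_mul_and_not_dvd _ hp 0
  rw [map_zero, sub_zero] at hr hdvd
  set k := (minpoly K F).rootMultiplicity 0
  -- The exponent `k + 1` in place of `k` makes the idempotent `a * X ^ (k + 1)` divisible by `X`
  -- even when `k = 0`.
  have hcop : IsCoprime (X ^ (k + 1)) r :=
    ((Polynomial.prime_X.coprime_iff_not_dvd).mpr hdvd).pow_left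
  obtain ⟨a, b, hab⟩ := hcop
  have hzero : aeval F (X ^ (k + 1) * r) = 0 := by
    rw [pow_succ', mul_assoc, ← hr, map_mul, minpoly.aeval, mul_zero]
  have hev : F.HasEigenvector η v := ⟨Module.End.mem_eigenspace_iff.mpr hF, hv⟩
  have hrη : r.eval η = 0 := by
    have h := Module.End.aeval_apply_of_hasEigenvector (p := X ^ (k + 1) * r) hev
    rw [hzero, LinearMap.zero_apply, eq_comm, smul_eq_zero, or_iff_left hv, eval_mul, eval_pow,
      eval_X] at h
    exact (mul_eq_zero.mp h).resolve_left (pow_ne_zero _ hη)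
  have hq : a * X ^ k * X = a * X ^ (k + 1) := by rw [pow_succ, mul_assoc]
  refine ⟨a * X ^ k, ?_, ?_⟩
  · rw [hq, ← map_mul, ← sub_eq_zero, ← map_sub]
    have : a * X ^ (k + 1) * (a * X ^ (k + 1)) - a * X ^ (k + 1) =
        -(a * b) * (X ^ (k + 1) * r) := by
      linear_combination (a * X ^ (k + 1)) * hab
    rw [this, map_mul, hzero, mul_zero]
  · rw [hq, Module.End.aeval_apply_of_hasEigenvector hev]
    have h := congrArg (Polynomial.eval η) hab
    rw [eval_add, eval_mul (p := b), hrη, mul_zero, add_zero, eval_one] at h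
    rw [h, one_smul]

end Polynomials

theorem opProd_comp_rev_succ {K W M : Type*} [Field K] [AddCommGroup W] [Module K W]
    [AddCommGroup M] [Module K M] (ρ : W →ₗ[K] Module.End K M) {k : ℕ} (v : Fin (k + 1) → W) :
    opProd ρ (v ∘ Fin.rev) = opProd ρ ((fun i => v i.succ) ∘ Fin.rev) * ρ (v 0) := by
  rw [opProd, List.ofFn_succ', List.concat_eq_append, List.prod_append]
  simp [opProd, Fin.rev_castSucc]

/-! ### Weights of the grading element. -/

namespace LieSuperalgebra

open Module

variable {g : LieSuperalgebra.{u}}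

namespace SuperAction

section Weights

variable {V E : Type*} [AddCommGroup V] [Module ℂ V] [AddCommGroup E] [Module ℂ E]
  (R : SuperAction g V) (R' : SuperAction g E) {h : g.even}

theorem ev_od_of_weight {x : g.odd} {c : ℂ} (hx : ⁅h, x⁆ = c • x) {v : V} {μ : ℂ}
    (hv : R.ev h v = μ • v) : R.ev h (R.od x v) = (μ + c) • R.od x v := by
  rw [ev_od, hv, hx, map_smul, map_smul, LinearMap.smul_apply, add_smul]

theorem ev_par_of_weight {v : V} {μ : ℂ} (hv : R.ev h v = μ • v) :
    R.ev h (R.par v) = μ • R.par v := by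
  rw [← par_ev, hv, map_smul]

theorem ev_par_pow_of_weight {v : V} {μ : ℂ} (hv : R.ev h v = μ • v) (k : ℕ) :
    R.ev h ((R.par ^ k) v) = μ • (R.par ^ k) v := by
  induction k with
  | zero => simpa using hv
  | succ k ih =>
    rw [pow_succ', Module.End.mul_apply]
    exact R.ev_par_of_weight ih

theorem ev_opProd_of_weight {W : Submodule ℂ g.odd} {k : ℕ} (w : Fin k → W) (c : Fin k → ℂ)
    (hw : ∀ i, ⁅h, (w i : g.odd)⁆ = c i • (w i : g.odd)) {v : V} {μ : ℂ}
    (hv : R.ev h v = μ • v) :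
    R.ev h (opProd (R.odOn W) w v) = (μ + ∑ i, c i) • opProd (R.odOn W) w v := by
  induction k with
  | zero => simpa using hv
  | succ k ih =>
    rw [opProd_succ, Module.End.mul_apply, LinearMap.domRestrict_apply,
      R.ev_od_of_weight (hw 0) (ih _ _ fun i => hw i.succ), Fin.sum_univ_succ]
    congr 1
    ring

/-- If `t` only sees the weight space of weight `μ`, a product of elements of negative weights
acts on `t` in the lowest possible way. -/
theorem exists_homAction_opProd_apply {W : Submodule ℂ g.odd} (k : ℕ) :
    ∃ ε : ℂ, ε ≠ 0 ∧ ∀ (w : Fin k → W) (c : Fin k → ℝ), (∀ i, c i < 0) →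
      (∀ i, ⁅h, (w i : g.odd)⁆ = (c i : ℂ) • (w i : g.odd)) →
      ∀ (t : V →ₗ[ℂ] E) (μ : ℂ), (∀ (ν : ℂ) v, R.ev h v = ν • v → ν ≠ μ → t v = 0) →
      ∀ (l : ℂ) (v : V), R.ev h v = l • v → μ.re ≤ l.re + ∑ i, c i →
      opProd ((homAction R R').odOn W) w t v =
        ε • (R'.par ^ k) (t ((R.par ^ k) (opProd (R.odOn W) (w ∘ Fin.rev) v))) := by
  induction k with
  | zero => exact ⟨1, one_ne_zero, fun w c _ _ t μ _ l v _ _ => by simp⟩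
  | succ k ih =>
    obtain ⟨ε, hε, ih⟩ := ih
    -- One sign comes from the supercommutator, the other `k` from moving parity past `k` odd
    -- operators.
    refine ⟨(-1) ^ (k + 1) * ε, mul_ne_zero (pow_ne_zero _ (neg_ne_zero.mpr one_ne_zero)) hε,
      fun w c hc hw t μ ht l v hv hle => ?_⟩
    rw [Fin.sum_univ_succ] at hle
    have hrev : ∀ i : Fin k, ⁅h, (((fun i => w i.succ) ∘ Fin.rev) i : g.odd)⁆ =
        ((c (Fin.rev i).succ : ℝ) : ℂ) • (((fun i => w i.succ) ∘ Fin.rev) i : g.odd) :=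
      fun i => hw _
    -- In the term where the first factor acts after the map, `t` meets a vector of weight with real
    -- part above that of `μ`, because `c 0 < 0`. That term vanishes.
    have h₁ : opProd ((homAction R R').odOn W) (fun i => w i.succ) t v = 0 := by
      rw [ih _ (fun i => c i.succ) (fun i => hc _) (fun i => hw _) t μ ht l v hv
        (by linarith [hc 0]), ht _ _ (R.ev_par_pow_of_weight
          (R.ev_opProd_of_weight _ _ hrev hv) k), map_zero, smul_zero]
      intro heq
      have := congrArg Complex.re heq
      rw [Complex.add_re, Complex.re_sum] at this
      simp only [Complex.ofReal_re] at this
      have hs := Equiv.sum_comp Fin.revPerm (fun i : Fin k => c i.succ)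
      simp only [Fin.revPerm_apply] at hs
      linarith [hc 0]
    have h₂ := R.ev_par_of_weight (R.ev_od_of_weight (hw 0) hv)
    rw [opProd_succ, Module.End.mul_apply, LinearMap.domRestrict_apply, homAction_od_apply, h₁,
      map_zero, zero_sub, ih _ (fun i => c i.succ) (fun i => hc _) (fun i => hw _) t μ ht _ _ h₂
        (by rw [Complex.add_re, Complex.ofReal_re]; linarith), opProd_comp_rev_succ,
      Module.End.mul_apply, LinearMap.domRestrict_apply]
    have h₃ : ∀ u : V, opProd (R.odOn W) ((fun i => w i.succ) ∘ Fin.rev) (R.par u) =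
        (-1 : ℂ) ^ k • R.par (opProd (R.odOn W) ((fun i => w i.succ) ∘ Fin.rev) u) := by
      intro u
      rw [par_opProd, smul_smul, ← pow_add, Even.neg_one_pow ⟨k, rfl⟩, one_smul]
    rw [h₃, map_smul, map_smul, map_smul, map_smul, map_smul, ← Module.End.mul_apply (R'.par),
      ← pow_succ', ← Module.End.mul_apply (R.par ^ k), ← pow_succ]
    module

end Weights

section Diagonal

variable {V : Type*} [AddCommGroup V] [Module ℂ V] [FiniteDimensional ℂ V]
  {R : SuperAction g V} {h : g.even}

/-- Central elements of `g₀` act diagonally on finite-dimensional semisimple modules. -/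
theorem IsSemisimple.iSup_eigenspace_eq_top (hR : R.IsSemisimple)
    (hh : ∀ a : g.even, ⁅a, h⁆ = 0) : ⨆ μ : ℂ, (R.ev h).eigenspace μ = ⊤ := by
  have hcomm : ∀ a v, R.ev h (R.ev a v) = R.ev a (R.ev h v) := fun a v => by
    rw [ev_ev R a h, hh, map_zero, LinearMap.zero_apply, add_zero]
  have mem_iSup : ∀ f : Module.End ℂ V, (∀ v, R.ev h (f v) = f (R.ev h v)) →
      ∀ v ∈ ⨆ μ : ℂ, (R.ev h).eigenspace μ, f v ∈ ⨆ μ : ℂ, (R.ev h).eigenspace μ := by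
    intro f hf v hv
    have : (⨆ μ : ℂ, (R.ev h).eigenspace μ) ≤
        (⨆ μ : ℂ, (R.ev h).eigenspace μ).comap f := by
      refine iSup_le fun μ v hv => Submodule.mem_iSup_of_mem μ ?_
      rw [Module.End.mem_eigenspace_iff] at hv ⊢
      rw [hf, hv, map_smul]
    exact this hv
  -- The sum of the eigenspaces has a stable complement; if nonzero, the complement would contain an
  -- eigenvector.
  obtain ⟨T, hT, hST⟩ := hR (⨆ μ : ℂ, (R.ev h).eigenspace μ)
    (fun a => mem_iSup _ (hcomm a)) (mem_iSup _ fun v => (par_ev R h v).symm)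
  by_contra hne
  have hTne : T ≠ ⊥ := fun hT => hne (by simpa [hT] using hST.sup_eq_top)
  have : Nontrivial T := Submodule.nontrivial_iff_ne_bot.mpr hTne
  obtain ⟨μ, hμ⟩ := Module.End.exists_eigenvalue ((R.ev h).restrict (hT h))
  obtain ⟨v, hv, hv0⟩ := hμ.exists_hasEigenvector
  have hv' : R.ev h v.1 = μ • v.1 :=
    congrArg Subtype.val (Module.End.mem_eigenspace_iff.mp hv)
  exact hv0 (Subtype.ext (Submodule.disjoint_def.mp hST.disjoint v.1
    (Submodule.mem_iSup_of_mem μ (Module.End.mem_eigenspace_iff.mpr hv')) v.2))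

end Diagonal

/-! ### Top weights, and liftability of the identity. -/

section Main

variable {V : Type w} [AddCommGroup V] [Module ℂ V] [FiniteDimensional ℂ V]
  {R : SuperAction g V} {h : g.even}
  {W W' : Submodule ℂ g.odd} {d d' : ℕ} (b : Basis (Fin d) ℂ W) (b' : Basis (Fin d') ℂ W')
  (c : Fin d → ℝ) (c' : Fin d' → ℝ)

/-- A nonzero idempotent endomorphism has a fixed weight vector whose weight has maximal real
part. -/
theorem exists_top_weight (hR : R.IsSemisimple) (hh : ∀ a : g.even, ⁅a, h⁆ = 0)
    (e : Module.End ℂ V) (he : IsHom R R e) (hee : e * e = e) (he0 : e ≠ 0) :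
    ∃ (l : ℂ) (v : V), v ≠ 0 ∧ e v = v ∧ R.ev h v = l • v ∧
      ∀ (μ : ℂ) (u : V), e u = u → R.ev h u = μ • u → l.re < μ.re → u = 0 := by
  let S : Set ℂ := {μ | ∃ v, v ≠ 0 ∧ e v = v ∧ R.ev h v = μ • v}
  have hfin : S.Finite := by
    refine (Module.End.finite_hasEigenvalue (R.ev h)).subset ?_
    rintro μ ⟨v, hv0, _, hv⟩
    exact Module.End.hasEigenvalue_of_hasEigenvector
      ⟨Module.End.mem_eigenspace_iff.mpr hv, hv0⟩
  have hne : S.Nonempty := by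
    by_contra hS
    apply he0
    have : (⊤ : Submodule ℂ V) ≤ LinearMap.ker e := by
      rw [← hR.iSup_eigenspace_eq_top hh]
      refine iSup_le fun μ v hv => ?_
      rw [Module.End.mem_eigenspace_iff] at hv
      by_contra hev
      exact hS ⟨μ, e v, hev, LinearMap.congr_fun hee v, by rw [← he.map_ev, hv, map_smul]⟩
    exact LinearMap.ker_eq_top.mp (top_le_iff.mp this)
  obtain ⟨l, ⟨v, hv0, hev, hv⟩, hmax⟩ := Set.exists_max_image S Complex.re hfin hne
  refine ⟨l, v, hv0, hev, hv, fun μ u heu hu hlt => ?_⟩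
  by_contra hu0
  exact absurd (hmax μ ⟨u, hu0, heu, hu⟩) (not_le.mpr hlt)

include c' in
/-- On fixed vectors of top weight, the top product of elements of negative weight is injective. -/
theorem eq_zero_of_top_weight (hR : R.IsSemisimple) (hh : ∀ a : g.even, ⁅a, h⁆ = 0)
    (hW' : IsAbelianStable W') (hc' : ∀ i, c' i < 0)
    (hb' : ∀ i, ⁅h, (b' i : g.odd)⁆ = (c' i : ℂ) • (b' i : g.odd))
    (hex : ∀ x ∈ W', x ≠ 0 → LinearMap.ker (R.od x) ≤ LinearMap.range (R.od x))
    (e : Module.End ℂ V) (he : IsHom R R e) (hee : e * e = e) (l : ℂ)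
    (hmax : ∀ (μ : ℂ) (u : V), e u = u → R.ev h u = μ • u → l.re < μ.re → u = 0)
    (v : V) (hev : e v = v) (hv : R.ev h v = l • v) (hv0 : opProd (R.odOn W') b' v = 0) :
    v = 0 := by
  have hmem := mem_iSup_range_of_opProd_eq_zero (R.odOn W') (R.odOn_mul_self hW')
    (fun x hx => hex x.1 x.2 (by simpa using hx)) b' v hv0
  -- `U` consists of the vectors whose image under `e` has no component of weight `l`. It contains
  -- `W' M`: reaching weight `l` by a negative weight vector requires starting above `l`, where `e`
  -- vanishes.
  let U : Submodule ℂ V := (⨆ (μ : ℂ) (_ : μ ≠ l), (R.ev h).eigenspace μ).comap e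
  have hU : ∀ i, LinearMap.range (R.od (b' i)) ≤ U := by
    rintro i _ ⟨m, rfl⟩
    have : (⊤ : Submodule ℂ V) ≤ U.comap (R.od (b' i)) := by
      rw [← hR.iSup_eigenspace_eq_top hh]
      refine iSup_le fun μ m hm => ?_
      rw [Module.End.mem_eigenspace_iff] at hm
      rw [Submodule.mem_comap, Submodule.mem_comap, he.map_od]
      have hem : R.ev h (e m) = μ • e m := by rw [← he.map_ev, hm, map_smul]
      by_cases hμ : μ + c' i = l
      · rw [hmax μ (e m) (LinearMap.congr_fun hee m) hem, map_zero]
        · exact zero_mem _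
        · rw [← hμ, Complex.add_re, Complex.ofReal_re]
          linarith [hc' i]
      · exact Submodule.mem_iSup_of_mem _ (Submodule.mem_iSup_of_mem hμ
          (Module.End.mem_eigenspace_iff.mpr (R.ev_od_of_weight (hb' i) hem)))
    exact this (Submodule.mem_top (x := m))
  have hle : (⨆ x, LinearMap.range (R.odOn W' x)) ≤ U := by
    refine iSup_le ?_
    rintro x _ ⟨m, rfl⟩
    rw [← b'.sum_repr x, map_sum, LinearMap.sum_apply]
    refine sum_mem fun i _ => ?_
    rw [map_smul, LinearMap.smul_apply]
    exact U.smul_mem _ (hU i ⟨m, rfl⟩)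
  have hvU : e v ∈ ⨆ (μ : ℂ) (_ : μ ≠ l), (R.ev h).eigenspace μ := hle hmem
  rw [hev] at hvU
  exact Submodule.disjoint_def.mp ((R.ev h).eigenspaces_iSupIndep l) v
    (Module.End.mem_eigenspace_iff.mpr hv) hvU

/-- Every nonzero idempotent `g`-endomorphism `e` admits a liftable endomorphism `f` such that
`e f` has an eigenvector with nonzero eigenvalue in the range of `e`. -/
theorem exists_isLiftable_apply_eq_smul (hR : R.IsSemisimple) (hh : ∀ a : g.even, ⁅a, h⁆ = 0)
    (hW : IsAbelianStable W) (hW' : IsAbelianStable W') (hsup : W ⊔ W' = ⊤)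
    (hc : ∀ i, 0 < c i) (hb : ∀ i, ⁅h, (b i : g.odd)⁆ = (c i : ℂ) • (b i : g.odd))
    (hc' : ∀ i, c' i < 0) (hb' : ∀ i, ⁅h, (b' i : g.odd)⁆ = (c' i : ℂ) • (b' i : g.odd))
    (hex : ∀ x ∈ W, x ≠ 0 → LinearMap.ker (R.od x) ≤ LinearMap.range (R.od x))
    (hex' : ∀ x ∈ W', x ≠ 0 → LinearMap.ker (R.od x) ≤ LinearMap.range (R.od x))
    (e : Module.End ℂ V) (he : IsHom R R e) (hee : e * e = e) (he0 : e ≠ 0) :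
    ∃ (f : Module.End ℂ V) (v : V) (η : ℂ),
      IsLiftable R f ∧ v ≠ 0 ∧ η ≠ 0 ∧ e v = v ∧ e (f v) = η • v := by
  obtain ⟨l, v₀, hv0, hev₀, hv₀, hmax⟩ := exists_top_weight hR hh e he hee he0
  -- The commutator action applies the factors from `W'` to the argument in reverse order.
  let br : Basis (Fin d') ℂ W' := b'.reindex Fin.revPerm
  have hbr : (⇑br : Fin d' → W') = ⇑b' ∘ Fin.rev := by
    funext i
    simp [br]
  have hbrw : ∀ i, ⁅h, (br i : g.odd)⁆ = ((c' (Fin.rev i) : ℝ) : ℂ) • (br i : g.odd) := fun i => by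
    rw [hbr]
    exact hb' _
  let ω : Module.End ℂ V := opProd (R.odOn W) b
  let ω' : Module.End ℂ V := opProd (R.odOn W') br
  let χ : g.even → ℂ := fun a => hW.character b a + hW'.character b' a
  have hω : ∀ a v, R.ev a (ω v) = ω (R.ev a v) + hW.character b a • ω v := fun a v =>
    LinearMap.congr_fun (R.ev_mul_opProd hW b a) v
  have hω' : ∀ a v, R.ev a (ω' v) = ω' (R.ev a v) + hW'.character b' a • ω' v := fun a v => by
    have := LinearMap.congr_fun (R.ev_mul_opProd hW' br a) v
    rw [IsAbelianStable.character, topCharacter_reindex] at this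
    exact this
  -- A generalized inverse of `ω' ω` carries exactly the twist required of the input of the trace.
  obtain ⟨t₁, ht₁, ht₁χ⟩ := exists_generalized_inverse hR hR (ω' * ω) χ
    (fun a v => by
      rw [Module.End.mul_apply, hω', hω, map_add, map_smul, Module.End.mul_apply]
      module)
    ((-1) ^ d' * (-1) ^ d)
    (fun v => by
      rw [Module.End.mul_apply, par_opProd, par_opProd, map_smul, smul_smul]
      rfl)
  -- The weight of `ω' v` for `v` of weight `l`. Restricting to it through `P` leaves a single term
  -- in the `W'`-product of the map.
  let μ : ℂ := l + ∑ i, (c' i : ℂ)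
  obtain ⟨P, hP, hPS, hPm⟩ := hR.exists_projection ((R.ev h).eigenspace μ)
    (fun a v hv => by
      rw [Module.End.mem_eigenspace_iff] at hv ⊢
      rw [ev_ev R h a, hv, ← lie_skew, hh, neg_zero, map_zero, LinearMap.zero_apply, add_zero,
        map_smul])
    (fun v hv => by
      rw [Module.End.mem_eigenspace_iff] at hv ⊢
      exact R.ev_par_of_weight hv)
  have hpp : ∀ v, (R.par ^ d') ((R.par ^ d') v) = v := fun v => by
    rw [← Module.End.mul_apply, ← (Commute.refl R.par).mul_pow, R.par_mul_par, one_pow, Module.End.one_apply]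
  have hpev : ∀ a v, (R.par ^ d') (R.ev a v) = R.ev a ((R.par ^ d') v) := fun a v =>
    LinearMap.congr_fun ((show Commute R.par (R.ev a) from R.par_mul_ev a).pow_left d') v
  -- The outer parity factors cancel those produced by `exists_homAction_opProd_apply`.
  let t₀ : Module.End ℂ V := R.par ^ d' * (t₁ * P) * R.par ^ d'
  have ht₀ : ∀ a v, R.ev a (t₀ v) = t₀ (R.ev a v) - χ a • t₀ v := fun a v => by
    simp only [t₀, Module.End.mul_apply]
    rw [← hpev, ht₁χ, hpev, hP, map_sub, map_smul]
  obtain ⟨ε, hε, hhom⟩ := exists_homAction_opProd_apply (h := h) (W := W') R R d'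
  have htop : ∀ v, e v = v → R.ev h v = l • v → ∀ x ∈ W, R.od x v = 0 := by
    intro v hev hv x hx
    have hxi : ∀ i, R.od (b i) v = 0 := fun i =>
      hmax _ _ (by rw [he.map_od, hev]) (R.ev_od_of_weight (hb i) hv) (by
        rw [Complex.add_re, Complex.ofReal_re]
        linarith [hc i])
    have : R.odOn W ⟨x, hx⟩ v = 0 := by
      rw [← b.sum_repr ⟨x, hx⟩, map_sum, LinearMap.sum_apply]
      refine Finset.sum_eq_zero fun i _ => ?_
      rw [map_smul, LinearMap.smul_apply]
      exact smul_eq_zero_of_right _ (hxi i)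
    exact this
  have key : ∀ v, e v = v → R.ev h v = l • v →
      e (opProd ((homAction R R).odOn W) b (opProd ((homAction R R).odOn W') b' t₀) v) =
        ε • v := by
    intro v hev hv
    have hωv : R.ev h (ω' v) = μ • ω' v := by
      have hs := Equiv.sum_comp Fin.revPerm (fun i => (c' i : ℂ))
      simp only [Fin.revPerm_apply] at hs
      rw [R.ev_opProd_of_weight br _ hbrw hv, hs]
    have h₁ : opProd ((homAction R R).odOn W') b' t₀ v = ε • t₁ (ω' v) := by
      rw [hhom b' c' hc' hb' t₀ μ ?_ l v hv ?_, ← hbr]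
      · simp only [t₀, Module.End.mul_apply, hpp]
        rw [hPS _ (Module.End.mem_eigenspace_iff.mpr hωv)]
      · intro ν u hu hνμ
        simp only [t₀, Module.End.mul_apply]
        have h₂ := R.ev_par_pow_of_weight hu d'
        have h₃ := hP h ((R.par ^ d') u)
        rw [h₂, map_smul, Module.End.mem_eigenspace_iff.mp (hPm _), ← sub_eq_zero,
          ← sub_smul] at h₃
        rw [(smul_eq_zero.mp h₃).resolve_left (sub_ne_zero.mpr hνμ), map_zero, map_zero]
      · simp [μ, Complex.add_re, Complex.re_sum]
    rw [homAction_opProd_apply_of_killed R R _ _ v (htop v hev hv), h₁, map_smul, map_smul]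
    congr 1
    -- Since `W` kills `v`, write `v = ω m`. The identity `ω' ω t₁ ω' ω m = ω' ω m` says that `ω t₁
    -- ω' v` and `v` have the same image under `ω'`. After applying `e` they agree, `ω'` being
    -- injective on fixed vectors of top weight.
    obtain ⟨m, hm⟩ := mem_range_opProd_of_forall_eq_zero (R.odOn W) (R.odOn_mul_self hW)
      (fun x hx => hex x.1 x.2 (by simpa using hx)) b v fun x => htop v hev hv x.1 x.2
    change e (ω (t₁ (ω' v))) = v
    have hm' : ω m = v := hm
    have h₂ : ω' (ω (t₁ (ω' v))) = ω' v := by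
      have := ht₁ m
      rw [Module.End.mul_apply, Module.End.mul_apply, hm'] at this
      exact this
    have hω'e : ∀ u, ω' (e u) = e (ω' u) := by
      intro u
      have : ∀ (k : ℕ) (x : Fin k → W'), opProd (R.odOn W') x (e u) =
          e (opProd (R.odOn W') x u) := by
        intro k
        induction k with
        | zero => simp
        | succ k ih =>
          intro x
          rw [opProd_succ, Module.End.mul_apply, ih, LinearMap.domRestrict_apply, ← he.map_od]
          rfl
      exact this _ _
    have h₃ : R.ev h (ω (t₁ (ω' v))) = l • ω (t₁ (ω' v)) := by
      rw [hω, ht₁χ, hω', hv]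
      simp only [map_sub, map_add, map_smul, χ]
      module
    rw [← sub_eq_zero]
    refine eq_zero_of_top_weight br (fun i => c' (Fin.rev i)) hR hh hW' (fun i => hc' _) hbrw hex'
      e he hee l hmax _ ?_ ?_ ?_
    · rw [map_sub, hev, ← Module.End.mul_apply, hee]
    · rw [map_sub, ← he.map_ev, h₃, hv, map_smul, smul_sub]
    · rw [map_sub]
      change ω' _ - ω' _ = 0
      rw [hω'e, h₂, ← hω'e, hev, sub_self]
  -- The two summands of the trace contribute equally: parity preserves the fixed vectors of weight
  -- `l`.
  refine ⟨relTrace R R b b' t₀, v₀, ε + ε, isLiftable_relTrace hW hW' hsup b b' t₀ ht₀, hv0, ?_,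
    hev₀, ?_⟩
  · rw [← two_mul]
    exact mul_ne_zero two_ne_zero hε
  · rw [relTrace, LinearMap.add_apply, map_add, key v₀ hev₀ hv₀, LinearMap.comp_apply,
      LinearMap.comp_apply, he.map_par, key _ (by rw [he.map_par, hev₀])
        (R.ev_par_of_weight hv₀), map_smul, par_par, add_smul]

/-- If every nonzero odd element of `W` and of `W'` acts with vanishing fibre, the identity is
liftable. -/
theorem isLiftable_one (hR : R.IsSemisimple) (hh : ∀ a : g.even, ⁅a, h⁆ = 0)
    (hW : IsAbelianStable W) (hW' : IsAbelianStable W') (hsup : W ⊔ W' = ⊤)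
    (hc : ∀ i, 0 < c i) (hb : ∀ i, ⁅h, (b i : g.odd)⁆ = (c i : ℂ) • (b i : g.odd))
    (hc' : ∀ i, c' i < 0) (hb' : ∀ i, ⁅h, (b' i : g.odd)⁆ = (c' i : ℂ) • (b' i : g.odd))
    (hex : ∀ x ∈ W, x ≠ 0 → LinearMap.ker (R.od x) ≤ LinearMap.range (R.od x))
    (hex' : ∀ x ∈ W', x ≠ 0 → LinearMap.ker (R.od x) ≤ LinearMap.range (R.od x)) :
    IsLiftable R 1 := by
  have hone : IsHom R R 1 := ⟨fun _ _ => rfl, fun _ _ => rfl, fun _ => rfl⟩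
  have haeval : ∀ (F : Module.End ℂ V), IsHom R R F → ∀ q : Polynomial ℂ,
      IsHom R R (Polynomial.aeval F q) := by
    intro F hF q
    induction q using Polynomial.induction_on' with
    | add p q hp hq => rw [map_add]; exact hp.add hq
    | monomial n a =>
      have hpow : IsHom R R (F ^ n) := by
        induction n with
        | zero => exact hone
        | succ n ih => exact ih.comp hF
      rw [Polynomial.aeval_monomial, Algebra.algebraMap_eq_smul_one, smul_one_mul]
      exact ⟨fun a v => by simp [hpow.map_ev], fun a v => by simp [hpow.map_od],
        fun v => by simp [hpow.map_par]⟩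
  -- Choose a liftable idempotent of maximal rank.
  let S : Set ℕ := {n | ∃ e, IsLiftable R e ∧ e * e = e ∧ finrank ℂ (LinearMap.range e) = n}
  have hbdd : ∀ n ∈ S, n ≤ finrank ℂ V := by
    rintro _ ⟨e, _, _, rfl⟩
    exact Submodule.finrank_le _
  have hSne : S.Nonempty := ⟨_, 0, isLiftable_zero, by simp, rfl⟩
  obtain ⟨e₀, he₀, hee₀, hrank⟩ := Nat.sSup_mem hSne ⟨_, hbdd⟩
  by_cases hone' : e₀ = 1
  · exact hone' ▸ he₀
  exfalso
  let e : Module.End ℂ V := 1 - e₀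
  have he : IsHom R R e := ⟨fun a v => by simp [e, he₀.isHom.map_ev],
    fun a v => by simp [e, he₀.isHom.map_od], fun v => by simp [e, he₀.isHom.map_par]⟩
  have hee : e * e = e := by
    simp only [e, sub_mul, mul_sub, hee₀, mul_one, one_mul, sub_self, sub_zero]
  have he₀e : e₀ * e = 0 := by simp [e, mul_sub, hee₀]
  have hee₀' : e * e₀ = 0 := by simp [e, sub_mul, hee₀]
  obtain ⟨f, v, η, hf, hv0, hη, hev, hfv⟩ := exists_isLiftable_apply_eq_smul b b' c c' hR hh hW hW'
    hsup hc hb hc' hb' hex hex' e he hee (sub_ne_zero.mpr (Ne.symm hone'))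
  -- A Fitting idempotent of `F` is liftable, being a multiple of `F`, and orthogonal to `e₀`. It
  -- fixes `v`, so adding it to `e₀` strictly increases the rank.
  let F : Module.End ℂ V := e * f * e
  have hF : IsLiftable R F := (hf.mul_left he).mul_right he
  have hFv : F v = η • v := by
    simp only [F, Module.End.mul_apply, hev, hfv]
  obtain ⟨q, hq, hqv⟩ := Module.End.exists_idempotent_aeval_mul F η hη v hv0 hFv
  set e₁ := Polynomial.aeval F (q * Polynomial.X) with he₁
  have he₁F : e₁ = Polynomial.aeval F q * F := by rw [he₁, map_mul, Polynomial.aeval_X]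
  have he₁F' : e₁ = F * Polynomial.aeval F q := by
    rw [he₁, mul_comm, map_mul, Polynomial.aeval_X]
  have h₁ : IsLiftable R e₁ := he₁F ▸ hF.mul_left (haeval F hF.isHom q)
  have h₂ : e₀ * e₁ = 0 := by
    rw [he₁F']
    simp only [F, ← mul_assoc, he₀e, zero_mul]
  have h₃ : e₁ * e₀ = 0 := by
    rw [he₁F]
    simp only [F, mul_assoc, hee₀', mul_zero]
  have hidem : (e₀ + e₁) * (e₀ + e₁) = e₀ + e₁ := by
    rw [add_mul, mul_add, mul_add, hee₀, h₂, h₃, hq, add_zero, zero_add]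
  have hlt : LinearMap.range e₀ < LinearMap.range (e₀ + e₁) := by
    have he₀v : e₀ v = 0 := by rw [← hev, ← Module.End.mul_apply, he₀e, LinearMap.zero_apply]
    refine lt_of_le_of_ne ?_ fun heq => ?_
    · rintro _ ⟨u, rfl⟩
      exact ⟨e₀ u, by
        rw [LinearMap.add_apply, ← Module.End.mul_apply, ← Module.End.mul_apply, hee₀, h₃,
          LinearMap.zero_apply, add_zero]⟩
    · have hv : v ∈ LinearMap.range e₀ :=
        heq ▸ ⟨v, by rw [LinearMap.add_apply, he₀v, hqv, zero_add]⟩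
      obtain ⟨u, rfl⟩ := hv
      rw [← Module.End.mul_apply, hee₀] at he₀v
      exact hv0 he₀v
  have hmem : finrank ℂ (LinearMap.range (e₀ + e₁)) ∈ S := ⟨_, he₀.add h₁, hidem, rfl⟩
  have := le_csSup ⟨_, hbdd⟩ hmem
  have := Submodule.finrank_lt_finrank_of_lt hlt
  omega

end Main

end SuperAction

end LieSuperalgebra

/-! ### Passage between supermodules and their total spaces. -/

namespace LieSuperalgebra

open Module

variable {g : LieSuperalgebra.{u}}

namespace SuperModule

/-- The total space of a `g`-module with the action of all homogeneous elements. -/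
def action (M : SuperModule.{u, w} g) : SuperAction g (M.even × M.odd) where
  ev :=
    { toFun := fun a =>
        (LieModule.toEnd ℂ g.even M.even a).prodMap (LieModule.toEnd ℂ g.even M.odd a)
      map_add' := fun a b => by ext <;> simp
      map_smul' := fun c a => by ext <;> simp }
  od :=
    { toFun := M.oddEnd
      map_add' := fun a b => by ext <;> simp [oddEnd]
      map_smul' := fun c a => by ext <;> simp [oddEnd] }
  ev_mul_ev a b := by ext <;> simp
  ev_mul_od a x := by
    ext <;> simp [oddEnd, M.lie_actEven, M.lie_actOdd, add_comm]
  od_mul_od x y := by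
    ext <;> simp [oddEnd, M.bracket_even, M.bracket_odd]
  par := LinearMap.prodMap 1 (-1)
  par_mul_par := by ext <;> simp
  par_mul_ev a := by ext <;> simp
  par_mul_od x := by ext <;> simp [oddEnd]

@[simp]
theorem action_ev (M : SuperModule.{u, w} g) (a : g.even) (v : M.even × M.odd) :
    M.action.ev a v = (⁅a, v.1⁆, ⁅a, v.2⁆) := rfl

@[simp]
theorem action_od (M : SuperModule.{u, w} g) (x : g.odd) (v : M.even × M.odd) :
    M.action.od x v = (M.actOdd x v.2, M.actEven x v.1) := rfl

@[simp]
theorem action_par (M : SuperModule.{u, w} g) (v : M.even × M.odd) :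
    M.action.par v = (v.1, -v.2) := rfl

/-- A parity-stable subspace is the direct sum of its homogeneous parts, obtained by averaging with
parity; each part is complemented separately. -/
theorem isSemisimple_action (M : SuperModule.{u, w} g)
    (h₀ : ComplementedLattice (LieSubmodule ℂ g.even M.even))
    (h₁ : ComplementedLattice (LieSubmodule ℂ g.even M.odd)) : M.action.IsSemisimple := by
  intro S hS hpar
  have hfst : ∀ v ∈ S, (v.1, (0 : M.odd)) ∈ S := fun v hv => by
    have h := S.smul_mem (2⁻¹ : ℂ) (S.add_mem hv (hpar v hv))
    convert h using 1
    ext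
    · simp only [action_par, Prod.smul_fst, Prod.fst_add, ← two_smul ℂ v.1, smul_smul]
      norm_num
    · simp
  have hsnd : ∀ v ∈ S, ((0 : M.even), v.2) ∈ S := fun v hv => by
    have h := S.sub_mem hv (hfst v hv)
    have h' : v - (v.1, 0) = (0, v.2) := by ext <;> simp
    rwa [h'] at h
  let S₀ : LieSubmodule ℂ g.even M.even :=
    { S.comap (LinearMap.inl ℂ M.even M.odd) with
      lie_mem := fun {a m} hm => by
        have := hS a _ hm
        simpa using this }
  let S₁ : LieSubmodule ℂ g.even M.odd :=
    { S.comap (LinearMap.inr ℂ M.even M.odd) with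
      lie_mem := fun {a m} hm => by
        have := hS a _ hm
        simpa using this }
  obtain ⟨T₀, hT₀⟩ := exists_isCompl S₀
  obtain ⟨T₁, hT₁⟩ := exists_isCompl S₁
  refine ⟨T₀.toSubmodule.prod T₁.toSubmodule, fun a v hv => ⟨T₀.lie_mem hv.1, T₁.lie_mem hv.2⟩,
    ?_, ?_⟩
  · rw [Submodule.disjoint_def]
    rintro v hv ⟨h₀, h₁⟩
    ext
    · have h : v.1 ∈ S₀ ⊓ T₀ := ⟨hfst v hv, h₀⟩
      rwa [hT₀.inf_eq_bot, LieSubmodule.mem_bot] at h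
    · have h : v.2 ∈ S₁ ⊓ T₁ := ⟨hsnd v hv, h₁⟩
      rwa [hT₁.inf_eq_bot, LieSubmodule.mem_bot] at h
  · rw [codisjoint_iff, eq_top_iff]
    intro v _
    obtain ⟨s, hs, t, ht, hst⟩ := (LieSubmodule.mem_sup _ _ _).mp
      (hT₀.sup_eq_top ▸ LieSubmodule.mem_top v.1 : v.1 ∈ S₀ ⊔ T₀)
    obtain ⟨s', hs', t', ht', hst'⟩ := (LieSubmodule.mem_sup _ _ _).mp
      (hT₁.sup_eq_top ▸ LieSubmodule.mem_top v.2 : v.2 ∈ S₁ ⊔ T₁)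
    refine Submodule.mem_sup.mpr ⟨(s, 0) + (0, s'), S.add_mem hs hs', (t, t'), ⟨ht, ht'⟩, ?_⟩
    ext <;> simp [hst, hst']

theorem isHom_of_hom {M N : SuperModule.{u, w} g} (f : M ⟶ N) :
    SuperAction.IsHom M.action N.action
      ((Hom.even f : M.even →ₗ[ℂ] N.even).prodMap (Hom.odd f : M.odd →ₗ[ℂ] N.odd)) where
  map_ev a v := by ext <;> simp
  map_od x v := by
    ext
    · exact Hom.map_actOdd f x v.2
    · exact Hom.map_actEven f x v.1
  map_par v := by ext <;> simp

/-- A parity-preserving equivariant map of total spaces comes from a morphism. -/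
theorem exists_hom_of_isHom {M N : SuperModule.{u, w} g} (f : M.even × M.odd →ₗ[ℂ] N.even × N.odd)
    (hf : SuperAction.IsHom M.action N.action f) :
    ∃ s : M ⟶ N, (∀ m, f (m, 0) = (Hom.even s m, 0)) ∧ ∀ m, f (0, m) = (0, Hom.odd s m) := by
  have h₀ : ∀ m, f (m, 0) = ((f (m, 0)).1, 0) := fun m => by
    have h := congrArg Prod.snd (hf.map_par (m, 0))
    simp only [action_par, neg_zero] at h
    ext
    · rfl
    · have : (2 : ℂ) • (f (m, 0)).2 = 0 := by
        rw [two_smul]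
        nth_rewrite 1 [h]
        exact neg_add_cancel _
      exact (smul_eq_zero.mp this).resolve_left two_ne_zero
  have h₁ : ∀ m, f (0, m) = (0, (f (0, m)).2) := fun m => by
    have h := congrArg Prod.fst (hf.map_par (0, m))
    have hm : ((0 : M.even), -m) = -(0, m) := by simp
    simp only [action_par, hm, map_neg, Prod.fst_neg] at h
    ext
    · have : (2 : ℂ) • (f (0, m)).1 = 0 := by
        rw [two_smul]
        nth_rewrite 1 [← h]
        exact neg_add_cancel _
      exact (smul_eq_zero.mp this).resolve_left two_ne_zero
    · rfl
  let s₀ : M.even →ₗ⁅ℂ, g.even⁆ N.even :=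
    { LinearMap.fst ℂ N.even N.odd ∘ₗ f ∘ₗ LinearMap.inl ℂ M.even M.odd with
      map_lie' := fun {a m} => by
        have h := congrArg Prod.fst (hf.map_ev a (m, 0))
        simpa using h }
  let s₁ : M.odd →ₗ⁅ℂ, g.even⁆ N.odd :=
    { LinearMap.snd ℂ N.even N.odd ∘ₗ f ∘ₗ LinearMap.inr ℂ M.even M.odd with
      map_lie' := fun {a m} => by
        have h := congrArg Prod.snd (hf.map_ev a (0, m))
        simpa using h }
  refine ⟨(⟨s₀, s₁, fun x m => ?_, fun x m => ?_⟩ : Hom M N), h₀, h₁⟩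
  · have h := congrArg Prod.snd (hf.map_od x (m, 0))
    simp only [action_od, map_zero] at h
    exact h
  · have h := congrArg Prod.fst (hf.map_od x (0, m))
    simp only [action_od, map_zero] at h
    exact h

/-- The vanishing of the fibre at a self-commuting element. -/
theorem ker_le_range_of_associatedVariety_eq (M : SuperModule.{u, w} g)
    (hM : M.associatedVariety = {0}) (x : g.odd) (hx : x ∈ g.selfCommutingCone) (hx0 : x ≠ 0) :
    LinearMap.ker (M.action.od x) ≤ LinearMap.range (M.action.od x) := by
  have hnot : ¬ Nontrivial (M.fiber x) := fun h => by
    have : x ∈ M.associatedVariety := ⟨hx, h⟩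
    rw [hM] at this
    exact hx0 this
  rw [Submodule.Quotient.nontrivial_iff, not_not] at hnot
  exact Submodule.submoduleOf_eq_top.mp hnot

end SuperModule

/-! ### Epimorphisms are surjective; projectivity from lifting. -/

section Quotient

theorem complementedLattice_of_surjective {L N N' : Type*} [LieRing L] [LieAlgebra ℂ L]
    [AddCommGroup N] [Module ℂ N] [LieRingModule L N] [LieModule ℂ L N]
    [AddCommGroup N'] [Module ℂ N'] [LieRingModule L N'] [LieModule ℂ L N']
    (f : N →ₗ⁅ℂ, L⁆ N') (hf : Function.Surjective f)
    (h : ComplementedLattice (LieSubmodule ℂ L N)) :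
    ComplementedLattice (LieSubmodule ℂ L N') := by
  refine ⟨fun A => ?_⟩
  obtain ⟨C, hC⟩ := exists_isCompl (A.comap f)
  refine ⟨C.map f, ?_, ?_⟩
  · rw [disjoint_iff, eq_bot_iff]
    rintro _ ⟨hA, hCm⟩
    obtain ⟨c, hc, rfl⟩ := LieSubmodule.mem_map _ |>.mp hCm
    have : c ∈ A.comap f ⊓ C := ⟨LieSubmodule.mem_comap.mpr hA, hc⟩
    rw [hC.inf_eq_bot, LieSubmodule.mem_bot] at this
    rw [this, map_zero]
    exact zero_mem _
  · rw [codisjoint_iff, eq_top_iff]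
    intro n _
    obtain ⟨n, rfl⟩ := hf n
    have hn : n ∈ A.comap f ⊔ C := hC.sup_eq_top ▸ LieSubmodule.mem_top n
    obtain ⟨a, ha, c, hc, rfl⟩ := (LieSubmodule.mem_sup _ _ _).mp hn
    exact (LieSubmodule.mem_sup _ _ _).mpr ⟨f a, LieSubmodule.mem_comap.mp ha, f c,
      (LieSubmodule.mem_map _).mpr ⟨c, hc, rfl⟩, (map_add f a c).symm⟩

/-- The quotient of a `g`-module by a homogeneous submodule. -/
def SuperModule.quotient (X : SuperModule.{u, w} g) (A : LieSubmodule ℂ g.even X.even)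
    (B : LieSubmodule ℂ g.even X.odd) (hA : ∀ x, ∀ m ∈ A, X.actEven x m ∈ B)
    (hB : ∀ x, ∀ m ∈ B, X.actOdd x m ∈ A) : SuperModule.{u, w} g where
  even := X.even ⧸ A
  odd := X.odd ⧸ B
  actEven :=
    { toFun := fun x => A.toSubmodule.mapQ B.toSubmodule (X.actEven x) (hA x)
      map_add' := fun x y => Submodule.linearMap_qext _ (by ext; simp)
      map_smul' := fun c x => Submodule.linearMap_qext _ (by ext; simp) }
  actOdd :=
    { toFun := fun x => B.toSubmodule.mapQ A.toSubmodule (X.actOdd x) (hB x)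
      map_add' := fun x y => Submodule.linearMap_qext _ (by ext; simp)
      map_smul' := fun c x => Submodule.linearMap_qext _ (by ext; simp) }
  lie_actEven a x m := by
    obtain ⟨m, rfl⟩ := LieSubmodule.Quotient.surjective_mk' A m
    exact congrArg (LieSubmodule.Quotient.mk' B) (X.lie_actEven a x m)
  lie_actOdd a x m := by
    obtain ⟨m, rfl⟩ := LieSubmodule.Quotient.surjective_mk' B m
    exact congrArg (LieSubmodule.Quotient.mk' A) (X.lie_actOdd a x m)
  bracket_even x y m := by
    obtain ⟨m, rfl⟩ := LieSubmodule.Quotient.surjective_mk' A m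
    exact congrArg (LieSubmodule.Quotient.mk' A) (X.bracket_even x y m)
  bracket_odd x y m := by
    obtain ⟨m, rfl⟩ := LieSubmodule.Quotient.surjective_mk' B m
    exact congrArg (LieSubmodule.Quotient.mk' B) (X.bracket_odd x y m)

open CategoryTheory

/-- The quotient by the image stays in the category, and the projection onto it agrees with zero
after the epimorphism. -/
theorem surjective_of_epi {E X : FinSemisimple.{u, w} g} (e : E ⟶ X) [Epi e] :
    Function.Surjective (SuperModule.Hom.even e.hom) ∧
      Function.Surjective (SuperModule.Hom.odd e.hom) := by
  let f : SuperModule.Hom E.obj X.obj := e.hom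
  let A := f.even.range
  let B := f.odd.range
  have hA : ∀ x, ∀ m ∈ A, X.obj.actEven x m ∈ B := by
    rintro x _ ⟨m, rfl⟩
    exact ⟨E.obj.actEven x m, f.map_actEven x m⟩
  have hB : ∀ x, ∀ m ∈ B, X.obj.actOdd x m ∈ A := by
    rintro x _ ⟨m, rfl⟩
    exact ⟨E.obj.actOdd x m, f.map_actOdd x m⟩
  obtain ⟨⟨h₁, h₂⟩, h₃, h₄⟩ := X.property
  let Q : FinSemisimple.{u, w} g := ⟨X.obj.quotient A B hA hB,
    ⟨Module.Finite.of_surjective (LieSubmodule.Quotient.mk' A : X.obj.even →ₗ[ℂ] X.obj.even ⧸ A)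
      (LieSubmodule.Quotient.surjective_mk' A),
    Module.Finite.of_surjective (LieSubmodule.Quotient.mk' B : X.obj.odd →ₗ[ℂ] X.obj.odd ⧸ B)
      (LieSubmodule.Quotient.surjective_mk' B)⟩,
    complementedLattice_of_surjective _ (LieSubmodule.Quotient.surjective_mk' A) h₃,
    complementedLattice_of_surjective _ (LieSubmodule.Quotient.surjective_mk' B) h₄⟩
  let π : SuperModule.Hom X.obj Q.obj :=
    ⟨LieSubmodule.Quotient.mk' A, LieSubmodule.Quotient.mk' B, fun _ _ => rfl, fun _ _ => rfl⟩
  let z : SuperModule.Hom X.obj Q.obj :=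
    ⟨0, 0, fun _ _ => (map_zero _).symm, fun _ _ => (map_zero _).symm⟩
  let π' : X ⟶ Q := ObjectProperty.homMk π
  let z' : X ⟶ Q := ObjectProperty.homMk z
  have h : e ≫ π' = e ≫ z' := by
    apply ObjectProperty.hom_ext
    refine SuperModule.Hom.ext (LieModuleHom.ext fun m => ?_) (LieModuleHom.ext fun m => ?_)
    · exact (LieSubmodule.Quotient.mk_eq_zero _).mpr ⟨m, rfl⟩
    · exact (LieSubmodule.Quotient.mk_eq_zero _).mpr ⟨m, rfl⟩
  have hπ : π = z := congrArg InducedCategory.Hom.hom ((cancel_epi e).mp h)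
  constructor
  · intro m
    have : LieSubmodule.Quotient.mk' A m = 0 :=
      congrArg (fun k : SuperModule.Hom X.obj Q.obj => k.even m) hπ
    exact (LieSubmodule.Quotient.mk_eq_zero _).mp this
  · intro m
    have : LieSubmodule.Quotient.mk' B m = 0 :=
      congrArg (fun k : SuperModule.Hom X.obj Q.obj => k.odd m) hπ
    exact (LieSubmodule.Quotient.mk_eq_zero _).mp this

theorem projective_of_isLiftable_one (M : FinSemisimple.{u, w} g)
    (hM : SuperAction.IsLiftable M.obj.action 1) : Projective M := by
  refine ⟨fun {E X} f e _ => ?_⟩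
  obtain ⟨he₀, he₁⟩ := surjective_of_epi e
  obtain ⟨s, hs, hps⟩ := hM.exists_lift E.obj.action X.obj.action
    (E.obj.isSemisimple_action E.property.2.1 E.property.2.2)
    (X.obj.isSemisimple_action X.property.2.1 X.property.2.2) _ _
    (SuperModule.isHom_of_hom e.hom) (he₀.prodMap he₁) (SuperModule.isHom_of_hom f.hom)
  obtain ⟨t, ht₀, ht₁⟩ := SuperModule.exists_hom_of_isHom s hs
  refine ⟨ObjectProperty.homMk t, ?_⟩
  apply ObjectProperty.hom_ext
  refine SuperModule.Hom.ext (LieModuleHom.ext fun m => ?_) (LieModuleHom.ext fun m => ?_)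
  · have h := congrArg Prod.fst (LinearMap.congr_fun hps (m, 0))
    rw [LinearMap.comp_apply, ht₀] at h
    exact h
  · have h := congrArg Prod.snd (LinearMap.congr_fun hps (0, m))
    rw [LinearMap.comp_apply, ht₁] at h
    exact h

end Quotient

/-! ### Splitting the odd part by the sign of the weight. -/

section Grading

variable {n : ℕ} (b : Basis (Fin n) ℂ g.odd) (c : Fin n → ℝ) (h : g.even)
  (hb : ∀ i, ⁅h, b i⁆ = (c i : ℂ) • b i)

/-- The span of the weight vectors whose weights satisfy `p`. -/
def weightSpan (p : ℝ → Prop) : Submodule ℂ g.odd :=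
  Submodule.span ℂ (Set.range fun i : {i // p (c i)} => b i)

theorem mem_weightSpan (p : ℝ → Prop) (x : g.odd) :
    x ∈ weightSpan b c p ↔ ∀ i, b.repr x i ≠ 0 → p (c i) := by
  have : (Set.range fun i : {i // p (c i)} => b i) = b '' {i | p (c i)} := by
    ext
    simp
  rw [weightSpan, this, b.mem_span_image]
  simp only [Set.subset_def, Finset.mem_coe, Finsupp.mem_support_iff]
  rfl

include hb in
theorem repr_lie_grading (x : g.odd) (j : Fin n) : b.repr ⁅h, x⁆ j = c j * b.repr x j := by
  have : b.coord j ∘ₗ LieModule.toEnd ℂ g.even g.odd h = (c j : ℂ) • b.coord j := by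
    refine b.ext fun i => ?_
    by_cases hij : i = j <;> simp [hb, hij]
  exact LinearMap.congr_fun this x

-- Brackets of weight vectors of weights `r` and `s` would have weight `r + s ≠ 0` under `h`, which
-- acts by zero on the even part; hence they vanish. Stability holds because even elements commute
-- with `h` and so preserve weights.
include hb in
theorem isAbelianStable_weightSpan (hh : ∀ a : g.even, ⁅a, h⁆ = 0) (p : ℝ → Prop)
    (hp : ∀ r s, p r → p s → r + s ≠ 0) : IsAbelianStable (weightSpan b c p) := by
  constructor
  · intro x hx y hy
    refine Submodule.span_induction₂ (p := fun x y _ _ => g.bracket x y = 0) ?_ ?_ ?_ ?_ ?_ ?_ ?_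
      hx hy
    · rintro _ _ ⟨⟨i, hi⟩, rfl⟩ ⟨⟨j, hj⟩, rfl⟩
      have h₁ := g.lie_bracket h (b i) (b j)
      rw [← lie_skew, hh, neg_zero, hb, hb, map_smul, map_smul, LinearMap.smul_apply,
        ← add_smul, eq_comm, smul_eq_zero] at h₁
      refine h₁.resolve_left ?_
      exact_mod_cast hp _ _ hi hj
    · intro y _; simp
    · intro x _; simp
    · intro x y z _ _ _ h₁ h₂; simp [h₁, h₂]
    · intro x y z _ _ _ h₁ h₂; simp [h₁, h₂]
    · intro r x y _ _ h₁; simp [h₁]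
    · intro r x y _ _ h₁; simp [h₁]
  · intro a x hx
    induction hx using Submodule.span_induction with
    | mem x hx =>
      obtain ⟨⟨i, hi⟩, rfl⟩ := hx
      rw [mem_weightSpan]
      intro j hj
      have h₁ := repr_lie_grading b c h hb ⁅a, b i⁆ j
      have h₂ : ⁅h, ⁅a, b i⁆⁆ = (c i : ℂ) • ⁅a, b i⁆ := by
        rw [leibniz_lie, ← lie_skew, hh, neg_zero, zero_lie, zero_add, hb, lie_smul]
      rw [h₂, map_smul, Finsupp.smul_apply, smul_eq_mul] at h₁
      have h₃ := mul_right_cancel₀ hj h₁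
      rw [Complex.ofReal_inj] at h₃
      exact h₃ ▸ hi
    | zero => rw [lie_zero]; exact zero_mem _
    | add x y _ _ hx hy => rw [lie_add]; exact add_mem hx hy
    | smul r x _ hx => rw [lie_smul]; exact Submodule.smul_mem _ _ hx

include hb in
theorem exists_weightSpan_basis (p : ℝ → Prop) :
    ∃ (d : ℕ) (e : Basis (Fin d) ℂ (weightSpan b c p)) (c' : Fin d → ℝ),
      (∀ i, p (c' i)) ∧ ∀ i, ⁅h, (e i : g.odd)⁆ = (c' i : ℂ) • (e i : g.odd) := by
  classical
  have hli : LinearIndependent ℂ fun i : {i // p (c i)} => b i :=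
    b.linearIndependent.comp _ Subtype.val_injective
  let σ := Fintype.equivFin {i // p (c i)}
  let e : Basis {i // p (c i)} ℂ (weightSpan b c p) := Basis.span hli
  refine ⟨_, e.reindex σ, fun i => c (σ.symm i), fun i => (σ.symm i).2, fun i => ?_⟩
  have he : (e (σ.symm i) : g.odd) = b (σ.symm i) :=
    congrArg Subtype.val (Basis.span_apply hli _)
  rw [Basis.reindex_apply, he, hb]

theorem weightSpan_sup_eq_top (hc : ∀ i, c i ≠ 0) :
    weightSpan b c (fun r => 0 < r) ⊔ weightSpan b c (fun r => r < 0) = ⊤ := by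
  rw [eq_top_iff, ← b.span_eq, Submodule.span_le]
  rintro _ ⟨i, rfl⟩
  rcases (hc i).lt_or_gt with h | h
  · exact Submodule.mem_sup_right (Submodule.subset_span ⟨⟨i, h⟩, rfl⟩)
  · exact Submodule.mem_sup_left (Submodule.subset_span ⟨⟨i, h⟩, rfl⟩)

end Grading

theorem varietyDetectsProjectivity_of_grading (hg : g.HasRealGradingElement) :
    VarietyDetectsProjectivity.{u, w} g := by
  intro M hM
  obtain ⟨h, hh, b, c, hbc⟩ := hg
  have hcent : ∀ a : g.even, ⁅a, h⁆ = 0 := (LieModule.mem_maxTrivSubmodule ℂ g.even g.even h).mp hh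
  have hb : ∀ i, ⁅h, b i⁆ = (c i : ℂ) • b i := fun i => (hbc i).2
  have hW := isAbelianStable_weightSpan b c h hb hcent (fun r => 0 < r)
    fun r s hr hs => (add_pos hr hs).ne'
  have hW' := isAbelianStable_weightSpan b c h hb hcent (fun r => r < 0)
    fun r s hr hs => (add_neg hr hs).ne
  obtain ⟨d, e, k, hk, he⟩ := exists_weightSpan_basis b c h hb (fun r => 0 < r)
  obtain ⟨d', e', k', hk', he'⟩ := exists_weightSpan_basis b c h hb (fun r => r < 0)
  obtain ⟨⟨h₁, h₂⟩, h₃, h₄⟩ := M.property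
  refine projective_of_isLiftable_one M (SuperAction.isLiftable_one e e' k k'
    (M.obj.isSemisimple_action h₃ h₄) hcent hW hW'
    (weightSpan_sup_eq_top b c fun i => (hbc i).1) hk he hk' he' ?_ ?_)
  · exact fun x hx hx0 => M.obj.ker_le_range_of_associatedVariety_eq hM x
      (hW.bracket_eq_zero x hx x hx) hx0
  · exact fun x hx hx0 => M.obj.ker_le_range_of_associatedVariety_eq hM x
      (hW'.bracket_eq_zero x hx x hx) hx0

end LieSuperalgebra

/-! ### Complete reducibility from adjoints, and reductivity. -/

section Reductive

open Module

/-- A module whose action is closed under adjoints for some inner product is completely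
reducible. -/
theorem complementedLattice_of_adjoint {L V H : Type*} [LieRing L] [LieAlgebra ℂ L]
    [AddCommGroup V] [Module ℂ V] [LieRingModule L V] [LieModule ℂ L V]
    [NormedAddCommGroup H] [InnerProductSpace ℂ H] [FiniteDimensional ℂ H] (ι : V →ₗ[ℂ] H)
    (hι : Function.Injective ι)
    (hadj : ∀ a : L, ∃ a' : L, ∀ x y : V, inner ℂ (ι ⁅a, x⁆) (ι y) = inner ℂ (ι x) (ι ⁅a', y⁆)) :
    ComplementedLattice (LieSubmodule ℂ L V) := by
  refine ⟨fun N => ?_⟩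
  let K : Submodule ℂ H := N.toSubmodule.map ι
  let C : LieSubmodule ℂ L V :=
    { Kᗮ.comap ι with
      lie_mem := by
        rintro a v hv _ ⟨n, hn, rfl⟩
        obtain ⟨a', ha'⟩ := hadj a
        rw [← inner_conj_symm, ha', inner_conj_symm]
        exact hv _ ⟨⁅a', n⁆, N.lie_mem hn, rfl⟩ }
  have hC : ∀ v, v ∈ C ↔ ι v ∈ Kᗮ := fun v => Iff.rfl
  refine ⟨C, ?_, ?_⟩
  · rw [disjoint_iff, eq_bot_iff]
    rintro v ⟨hv, hv'⟩
    have h : ι v = 0 := inner_self_eq_zero.mp (((hC v).mp hv') _ ⟨v, hv, rfl⟩)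
    rw [LieSubmodule.mem_bot]
    exact hι (h.trans (map_zero ι).symm)
  · rw [codisjoint_iff, eq_top_iff]
    intro v _
    obtain ⟨k, ⟨n, hn, rfl⟩, z, hz, hkz⟩ := K.exists_add_mem_mem_orthogonal (ι v)
    refine (LieSubmodule.mem_sup _ _ _).mpr ⟨n, hn, v - n, ?_, by abel⟩
    rw [hC, map_sub, hkz, add_sub_cancel_left]
    exact hz

/-- A Lie algebra with completely reducible adjoint representation is reductive. -/
theorem hasCentralRadical_of_complementedLattice {L : Type*} [LieRing L] [LieAlgebra ℂ L]
    [FiniteDimensional ℂ L] (h : ComplementedLattice (LieSubmodule ℂ L L)) :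
    LieAlgebra.HasCentralRadical ℂ L := by
  apply LieAlgebra.hasCentralRadical_of_radical_le
  set R : LieIdeal ℂ L := LieAlgebra.radical ℂ L
  -- With `J` a complement of `D`, the radical is `D ⊔ R ⊓ J`, and `R ⊓ J` commutes with `R` since
  -- such brackets lie in `D ⊓ J`. Hence `D = ⁅D, D⁆`, and solvability forces `D = ⊥`. The radical
  -- then commutes with itself and with its complement `I`.
  set D : LieIdeal ℂ L := ⁅R, R⁆ with hD
  obtain ⟨J, hJ⟩ := exists_isCompl D
  obtain ⟨I, hI⟩ := exists_isCompl R
  have hDR : D ≤ R := LieSubmodule.lie_le_left _ _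
  have hsup : D ⊔ R ⊓ J = R := by
    rw [inf_comm, ← sup_inf_assoc_of_le J hDR, hJ.sup_eq_top, top_inf_eq]
  have hAR : ⁅R ⊓ J, R⁆ = ⊥ := by
    rw [eq_bot_iff, ← hJ.inf_eq_bot]
    exact le_inf (LieSubmodule.mono_lie_left _ inf_le_left)
      ((LieSubmodule.lie_le_left _ _).trans inf_le_right)
  have hDD : ⁅D, D⁆ = D := by
    have h₁ : ⁅D, R⁆ = D := by
      conv_rhs => rw [hD, ← hsup, LieSubmodule.sup_lie, hsup, hAR, sup_bot_eq]
    have h₂ : ⁅D, R ⊓ J⁆ = ⊥ := by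
      rw [eq_bot_iff, ← hAR, LieSubmodule.lie_comm]
      exact LieSubmodule.mono_lie_right _ hDR
    conv_rhs => rw [← h₁, ← hsup, LieSubmodule.lie_sup, h₂, sup_bot_eq]
  have hbot : D = ⊥ := by
    obtain ⟨k, hk⟩ := (LieAlgebra.isSolvable_iff ℂ R).mp
      (inferInstanceAs (LieAlgebra.IsSolvable (LieAlgebra.radical ℂ L)))
    rw [LieIdeal.derivedSeries_eq_bot_iff] at hk
    have hD' : ∀ k, LieAlgebra.derivedSeriesOfIdeal ℂ L k D = D := by
      intro k
      induction k with
      | zero => rfl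
      | succ k ih => rw [LieAlgebra.derivedSeriesOfIdeal_succ, ih, hDD]
    rw [eq_bot_iff, ← hk, ← hD' k]
    exact LieAlgebra.derivedSeriesOfIdeal_mono hDR k
  intro r hr
  rw [LieModule.mem_maxTrivSubmodule]
  intro x
  have hx : x ∈ R ⊔ I := hI.sup_eq_top ▸ LieSubmodule.mem_top x
  obtain ⟨y, hy, z, hz, rfl⟩ := (LieSubmodule.mem_sup _ _ _).mp hx
  have h₁ : ⁅y, r⁆ ∈ (⊥ : LieIdeal ℂ L) := hbot ▸ LieSubmodule.lie_mem_lie hy hr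
  have h₂ : ⁅z, r⁆ ∈ R ⊓ I := ⟨lie_mem_right ℂ L R z r hr, lie_mem_left ℂ L I z r hz⟩
  rw [hI.inf_eq_bot] at h₂
  rw [LieSubmodule.mem_bot] at h₁ h₂
  rw [add_lie, h₁, h₂, add_zero]

end Reductive

/-! ### The concrete families. -/

namespace LieSuperalgebra

open Module

/-- A central even element whose adjoint action on the odd part squares to a positive scalar is a
real grading element. -/
theorem hasRealGradingElement_of_sq {g : LieSuperalgebra.{u}} [FiniteDimensional ℂ g.odd]
    (h : g.even) (hh : ∀ a : g.even, ⁅a, h⁆ = 0) (r : ℝ) (hr : r ≠ 0)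
    (hsq : ∀ x : g.odd, ⁅h, ⁅h, x⁆⁆ = ((r : ℂ) ^ 2) • x) : g.HasRealGradingElement := by
  have hr' : (r : ℂ) ≠ 0 := Complex.ofReal_ne_zero.mpr hr
  let T : Module.End ℂ g.odd := LieModule.toEnd ℂ g.even g.odd h
  have hTE : ∀ c : ℂ, ∀ x ∈ T.eigenspace c, ⁅h, x⁆ = c • x := fun c x hx =>
    Module.End.mem_eigenspace_iff.mp hx
  -- As `T² = r²`, the projections to the two eigenspaces are `½ (1 ± r⁻¹ T)`.
  have hcompl : IsCompl (T.eigenspace (r : ℂ)) (T.eigenspace (-(r : ℂ))) := by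
    constructor
    · rw [Submodule.disjoint_def]
      intro x hx hx'
      have h₁ := (hTE _ x hx).symm.trans (hTE _ x hx')
      rw [neg_smul, ← sub_eq_zero, sub_neg_eq_add, ← add_smul, smul_eq_zero, ← two_mul] at h₁
      exact h₁.resolve_left (mul_ne_zero two_ne_zero hr')
    · rw [codisjoint_iff, eq_top_iff]
      intro x _
      refine Submodule.mem_sup.mpr ⟨(2⁻¹ : ℂ) • (x + (r : ℂ)⁻¹ • ⁅h, x⁆), ?_,
        (2⁻¹ : ℂ) • (x - (r : ℂ)⁻¹ • ⁅h, x⁆), ?_, ?_⟩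
      · rw [Module.End.mem_eigenspace_iff]
        change ⁅h, _⁆ = _
        rw [lie_smul, lie_add, lie_smul, hsq]
        match_scalars <;> field_simp
      · rw [Module.End.mem_eigenspace_iff]
        change ⁅h, _⁆ = _
        rw [lie_smul, lie_sub, lie_smul, hsq]
        match_scalars <;> field_simp
      · match_scalars <;> norm_num
  let b₀ := ((finBasis ℂ (T.eigenspace (r : ℂ))).prod
    (finBasis ℂ (T.eigenspace (-(r : ℂ))))).map (Submodule.prodEquivOfIsCompl _ _ hcompl)
  let σ := Fintype.equivFinOfCardEq (finrank_eq_card_basis b₀).symm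
  refine ⟨h, (LieModule.mem_maxTrivSubmodule ℂ g.even g.even h).mpr hh, b₀.reindex σ,
    fun i => Sum.elim (fun _ => r) (fun _ => -r) (σ.symm i), fun i => ?_⟩
  rw [Basis.reindex_apply]
  beta_reduce
  generalize σ.symm i = j
  rcases j with j | j
  · refine ⟨hr, ?_⟩
    have : b₀ (Sum.inl j) = (finBasis ℂ (T.eigenspace (r : ℂ)) j : g.odd) := by
      simp [b₀]
    rw [this]
    exact hTE _ _ (Subtype.mem _)
  · refine ⟨neg_ne_zero.mpr hr, ?_⟩
    have : b₀ (Sum.inr j) = (finBasis ℂ (T.eigenspace (-(r : ℂ))) j : g.odd) := by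
      simp [b₀]
    rw [this, Sum.elim_inr, Complex.ofReal_neg]
    exact hTE _ _ (Subtype.mem _)

section Matrices

open Matrix

variable {N : Type}

/-- A matrix as a vector of the Euclidean space of its entries. -/
noncomputable def matrixToEuclidean : Matrix N N ℂ →ₗ[ℂ] EuclideanSpace ℂ (N × N) where
  toFun X := WithLp.toLp 2 fun p => X p.1 p.2
  map_add' _ _ := rfl
  map_smul' _ _ := rfl

theorem matrixToEuclidean_injective :
    Function.Injective (matrixToEuclidean : Matrix N N ℂ → EuclideanSpace ℂ (N × N)) := by
  intro X Y h
  ext i j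
  exact congrArg (fun v : EuclideanSpace ℂ (N × N) => v (i, j)) h

variable [Fintype N]

theorem inner_matrixToEuclidean (X Y : Matrix N N ℂ) :
    inner ℂ (matrixToEuclidean X) (matrixToEuclidean Y) = trace (Xᴴ * Y) := by
  change inner ℂ (WithLp.toLp 2 fun p : N × N => X p.1 p.2)
    (WithLp.toLp 2 fun p : N × N => Y p.1 p.2) = _
  simp only [EuclideanSpace.inner_eq_star_dotProduct, dotProduct, Fintype.sum_prod_type, trace, diag_apply, mul_apply, conjTranspose_apply]
  rw [Finset.sum_comm]
  simp [mul_comm]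

/-- For the form `tr(Xᴴ Y)`, the adjoint of `ad a` is `ad aᴴ`, by cyclicity of the trace. -/
theorem inner_commutator (a X Y : Matrix N N ℂ) :
    inner ℂ (matrixToEuclidean (a * X - X * a)) (matrixToEuclidean Y) =
      inner ℂ (matrixToEuclidean X) (matrixToEuclidean (aᴴ * Y - Y * aᴴ)) := by
  rw [inner_matrixToEuclidean, inner_matrixToEuclidean, conjTranspose_sub, conjTranspose_mul,
    conjTranspose_mul, sub_mul, mul_sub, trace_sub, trace_sub, Matrix.mul_assoc Xᴴ,
    Matrix.mul_assoc aᴴ, trace_mul_comm aᴴ, Matrix.mul_assoc]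

variable [DecidableEq N]

/-- Lie superalgebras of matrices whose even part is closed under conjugate transposition are
quasireductive. -/
theorem isQuasireductive_ofAssociative (k₀ k₁ : Submodule ℂ (Matrix N N ℂ))
    (h₀₀ : ∀ a ∈ k₀, ∀ b ∈ k₀, a * b - b * a ∈ k₀)
    (h₀₁ : ∀ a ∈ k₀, ∀ x ∈ k₁, a * x - x * a ∈ k₁)
    (h₁₁ : ∀ x ∈ k₁, ∀ y ∈ k₁, x * y + y * x ∈ k₀) (hstar : ∀ a ∈ k₀, aᴴ ∈ k₀) :
    (ofAssociative k₀ k₁ h₀₀ h₀₁ h₁₁).IsQuasireductive := by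
  let g := ofAssociative k₀ k₁ h₀₀ h₀₁ h₁₁
  have hfin₀ : FiniteDimensional ℂ g.even := inferInstanceAs (FiniteDimensional ℂ k₀)
  have hfin₁ : FiniteDimensional ℂ g.odd := inferInstanceAs (FiniteDimensional ℂ k₁)
  let ι₀ : g.even →ₗ[ℂ] Matrix N N ℂ := k₀.subtype
  let ι₁ : g.odd →ₗ[ℂ] Matrix N N ℂ := k₁.subtype
  have hι₀ : ∀ a b : g.even, ι₀ ⁅a, b⁆ = ι₀ a * ι₀ b - ι₀ b * ι₀ a := fun _ _ => rfl
  have hι₁ : ∀ (a : g.even) (x : g.odd), ι₁ ⁅a, x⁆ = ι₀ a * ι₁ x - ι₁ x * ι₀ a := fun _ _ => rfl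
  have hadj : ∀ a : g.even, ∃ a' : g.even, ι₀ a' = (ι₀ a)ᴴ := fun a =>
    ⟨(⟨_, hstar _ a.2⟩ : k₀), rfl⟩
  refine ⟨hfin₀, hfin₁, hasCentralRadical_of_complementedLattice ?_, ?_⟩
  · refine complementedLattice_of_adjoint (matrixToEuclidean (N := N) ∘ₗ ι₀)
      (fun _ _ h => Subtype.ext (matrixToEuclidean_injective h)) fun a => ?_
    obtain ⟨a', ha'⟩ := hadj a
    refine ⟨a', fun x y => ?_⟩
    simp only [LinearMap.comp_apply, hι₀, ha']
    exact inner_commutator _ _ _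
  · refine complementedLattice_of_adjoint (matrixToEuclidean (N := N) ∘ₗ ι₁)
      (fun _ _ h => Subtype.ext (matrixToEuclidean_injective h)) fun a => ?_
    obtain ⟨a', ha'⟩ := hadj a
    refine ⟨a', fun x y => ?_⟩
    simp only [LinearMap.comp_apply, hι₁, ha']
    exact inner_commutator _ _ _

theorem hasRealGradingElement_ofAssociative (k₀ k₁ : Submodule ℂ (Matrix N N ℂ))
    (h₀₀ : ∀ a ∈ k₀, ∀ b ∈ k₀, a * b - b * a ∈ k₀)
    (h₀₁ : ∀ a ∈ k₀, ∀ x ∈ k₁, a * x - x * a ∈ k₁)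
    (h₁₁ : ∀ x ∈ k₁, ∀ y ∈ k₁, x * y + y * x ∈ k₀) (h : Matrix N N ℂ) (hk : h ∈ k₀)
    (hcomm : ∀ a ∈ k₀, a * h = h * a) (r : ℝ) (hr : r ≠ 0)
    (hsq : ∀ x ∈ k₁, h * (h * x - x * h) - (h * x - x * h) * h = ((r : ℂ) ^ 2) • x) :
    (ofAssociative k₀ k₁ h₀₀ h₀₁ h₁₁).HasRealGradingElement := by
  let g := ofAssociative k₀ k₁ h₀₀ h₀₁ h₁₁
  have hfin₁ : FiniteDimensional ℂ g.odd := inferInstanceAs (FiniteDimensional ℂ k₁)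
  refine hasRealGradingElement_of_sq (g := g) (⟨h, hk⟩ : k₀) (fun a => ?_) r hr fun x => ?_
  · exact Subtype.ext (sub_eq_zero.mpr (hcomm _ a.2))
  · exact Subtype.ext (hsq _ x.2)

variable {p q : Type} [Fintype p] [Fintype q] [DecidableEq p] [DecidableEq q]
  (S₀ : Submodule ℂ (Matrix p p ℂ × Matrix q q ℂ))
  (S₁ : Submodule ℂ (Matrix p q ℂ × Matrix q p ℂ))
  (h₀₀ : ∀ A D A' D', (A, D) ∈ S₀ → (A', D') ∈ S₀ → (A * A' - A' * A, D * D' - D' * D) ∈ S₀)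
  (h₀₁ : ∀ A D B C, (A, D) ∈ S₀ → (B, C) ∈ S₁ → (A * B - B * D, D * C - C * A) ∈ S₁)
  (h₁₁ : ∀ B C B' C', (B, C) ∈ S₁ → (B', C') ∈ S₁ → (B * C' + B' * C, C * B' + C' * B) ∈ S₀)

theorem isQuasireductive_ofBlocks (hstar : ∀ A D, (A, D) ∈ S₀ → (Aᴴ, Dᴴ) ∈ S₀) :
    (ofBlocks S₀ S₁ h₀₀ h₀₁ h₁₁).IsQuasireductive := by
  refine isQuasireductive_ofAssociative _ _ _ _ _ ?_
  rintro _ ⟨A, D, h, rfl⟩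
  exact ⟨_, _, hstar A D h, by simp [fromBlocks_conjTranspose]⟩

theorem hasRealGradingElement_ofBlocks (A : Matrix p p ℂ) (D : Matrix q q ℂ) (hS : (A, D) ∈ S₀)
    (hcomm : ∀ A' D', (A', D') ∈ S₀ → A' * A = A * A' ∧ D' * D = D * D') (r : ℝ) (hr : r ≠ 0)
    (hB : ∀ B C, (B, C) ∈ S₁ →
      A * (A * B - B * D) - (A * B - B * D) * D = ((r : ℂ) ^ 2) • B ∧
      D * (D * C - C * A) - (D * C - C * A) * A = ((r : ℂ) ^ 2) • C) :
    (ofBlocks S₀ S₁ h₀₀ h₀₁ h₁₁).HasRealGradingElement := by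
  refine hasRealGradingElement_ofAssociative _ _ _ _ _ (fromBlocks A 0 0 D) ⟨A, D, hS, rfl⟩ ?_ r hr
    ?_
  · rintro _ ⟨A', D', h, rfl⟩
    simp [fromBlocks_multiply, hcomm A' D' h]
  · rintro _ ⟨B, C, h, rfl⟩
    obtain ⟨h₁, h₂⟩ := hB B C h
    simp only [fromBlocks_multiply, fromBlocks_smul, sub_eq_add_neg, fromBlocks_neg,
      fromBlocks_add] at *
    simp [h₁, h₂]

theorem isQuasireductive_gl (m n : ℕ) : (gl m n).IsQuasireductive :=
  isQuasireductive_ofBlocks _ _ _ _ _ fun _ _ _ => Submodule.mem_top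

theorem hasRealGradingElement_gl (m n : ℕ) : (gl m n).HasRealGradingElement :=
  hasRealGradingElement_ofBlocks _ _ _ _ _ 1 0 Submodule.mem_top (by simp) 1 one_ne_zero
    (by simp)

theorem isQuasireductive_sl (m n : ℕ) : (sl m n).IsQuasireductive := by
  refine isQuasireductive_ofBlocks _ _ _ _ _ fun A D h => ?_
  change trace A - trace D = 0 at h
  change trace Aᴴ - trace Dᴴ = 0
  rw [trace_conjTranspose, trace_conjTranspose, ← star_sub, h, star_zero]

/-- The element `diag(n, m)` has supertrace `mn - nm = 0` and eigenvalues `±(n - m)` on the odd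
blocks. -/
theorem hasRealGradingElement_sl (m n : ℕ) (hmn : m ≠ n) : (sl m n).HasRealGradingElement := by
  refine hasRealGradingElement_ofBlocks _ _ _ _ _ ((n : ℂ) • 1) ((m : ℂ) • 1) ?_ (by simp)
    ((n : ℝ) - m) (sub_ne_zero.mpr (by exact_mod_cast hmn.symm)) fun B C _ => ?_
  · change trace ((n : ℂ) • (1 : Matrix (Fin m) (Fin m) ℂ)) -
      trace ((m : ℂ) • (1 : Matrix (Fin n) (Fin n) ℂ)) = 0
    simp [trace_smul, mul_comm]
  · push_cast
    simp only [Matrix.smul_mul, Matrix.mul_smul, Matrix.one_mul, Matrix.mul_one]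
    constructor <;> module

theorem isQuasireductive_osp (m n : ℕ) : (osp m n).IsQuasireductive := by
  refine isQuasireductive_ofBlocks _ _ _ _ _ fun A D h => ?_
  obtain ⟨h₁, h₂⟩ := h
  have hJ : (J (Fin n) ℂ)ᴴ = -J (Fin n) ℂ := by
    rw [← J_transpose]
    ext i j
    rcases i with i | i <;> rcases j with j | j <;> simp [J, Matrix.one_apply]
  have hJJ := J_squared (Fin n) ℂ
  refine ⟨?_, ?_⟩
  · have := congrArg conjTranspose h₁
    rw [conjTranspose_add, conjTranspose_zero] at this
    exact this
  · have h₃ := congrArg conjTranspose h₂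
    rw [conjTranspose_add, conjTranspose_zero, conjTranspose_mul, conjTranspose_mul, hJ] at h₃
    -- Multiplying by `J` on both sides and using `J² = -1` returns the conjugated relation to the
    -- defining form.
    have h₄ : J (Fin n) ℂ * (-J (Fin n) ℂ * Dᵀᴴ + Dᴴ * -J (Fin n) ℂ) * J (Fin n) ℂ = 0 := by
      rw [h₃, Matrix.mul_zero, Matrix.zero_mul]
    rw [Matrix.mul_add, Matrix.add_mul, ← Matrix.mul_assoc, Matrix.mul_neg, hJJ, neg_neg,
      Matrix.one_mul, Matrix.mul_assoc, Matrix.mul_assoc, Matrix.neg_mul, hJJ, neg_neg,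
      Matrix.mul_one] at h₄
    exact h₄

/-- The orthogonal part `so(2)` is abelian. The factor `Complex.I` makes the square of the chosen
generator `1`, so its eigenvalues are real. -/
theorem hasRealGradingElement_osp (n : ℕ) : (osp 2 n).HasRealGradingElement := by
  refine hasRealGradingElement_ofBlocks _ _ _ _ _ !![0, Complex.I; -Complex.I, 0] 0 ?_
    (fun A D h => ?_) 1 one_ne_zero fun B C _ => ?_
  · refine ⟨?_, by simp⟩
    ext i j
    fin_cases i <;> fin_cases j <;> simp
  · obtain ⟨h₁, -⟩ := h
    refine ⟨?_, by simp⟩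
    have h00 := congrFun (congrFun h₁ 0) 0
    have h01 := congrFun (congrFun h₁ 0) 1
    have h11 := congrFun (congrFun h₁ 1) 1
    simp only [Matrix.add_apply, transpose_apply, Matrix.zero_apply] at h00 h01 h11
    ext i j
    fin_cases i <;> fin_cases j <;> simp [Matrix.mul_apply, Fin.sum_univ_two]
    · linear_combination (-Complex.I) * h01
    · linear_combination (Complex.I / 2) * h00 - (Complex.I / 2) * h11
    · linear_combination (Complex.I / 2) * h11 - (Complex.I / 2) * h00
    · linear_combination (Complex.I) * h01
  · have hI : (!![0, Complex.I; -Complex.I, 0] : Matrix (Fin 2) (Fin 2) ℂ) *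
        !![0, Complex.I; -Complex.I, 0] = 1 := by
      ext i j
      fin_cases i <;> fin_cases j <;> simp
    generalize (!![0, Complex.I; -Complex.I, 0] : Matrix (Fin 2) (Fin 2) ℂ) = S at hI
    simp only [Matrix.mul_zero, Matrix.zero_mul, sub_zero, zero_sub, Matrix.neg_mul, neg_neg,
      Complex.ofReal_one, one_pow, one_smul]
    rw [← Matrix.mul_assoc, hI, Matrix.one_mul, Matrix.mul_assoc, hI, Matrix.mul_one]
    exact ⟨rfl, rfl⟩

theorem isQuasireductive_periplectic (n : ℕ) : (periplectic n).IsQuasireductive := by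
  refine isQuasireductive_ofBlocks _ _ _ _ _ fun A D h => ?_
  change D = -Aᵀ at h
  change Dᴴ = -Aᴴᵀ
  rw [h, conjTranspose_neg]
  rfl

/-- The element `diag(1, -1)` acts by `2` on the symmetric block and by `-2` on the skew-symmetric
one. -/
theorem hasRealGradingElement_periplectic (n : ℕ) : (periplectic n).HasRealGradingElement := by
  refine hasRealGradingElement_ofBlocks _ _ _ _ _ 1 (-1) ?_ (by simp) 2 two_ne_zero
    fun B C _ => ?_
  · change (-1 : Matrix (Fin n) (Fin n) ℂ) = -1ᵀ
    simp
  · push_cast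
    simp only [Matrix.neg_mul, Matrix.mul_neg, Matrix.one_mul, Matrix.mul_one]
    constructor <;> module

end Matrices

end LieSuperalgebra

theorem theorem10p5 :
    (∀ g : LieSuperalgebra.{u}, g.IsQuasireductive → g.HasRealGradingElement →
      LieSuperalgebra.VarietyDetectsProjectivity.{u, w} g) ∧
    (∀ m n : ℕ, (LieSuperalgebra.gl m n).IsQuasireductive ∧
      (LieSuperalgebra.gl m n).HasRealGradingElement ∧
      LieSuperalgebra.VarietyDetectsProjectivity.{0, w} (LieSuperalgebra.gl m n)) ∧
    (∀ m n : ℕ, m ≠ n → (LieSuperalgebra.sl m n).IsQuasireductive ∧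
      (LieSuperalgebra.sl m n).HasRealGradingElement ∧
      LieSuperalgebra.VarietyDetectsProjectivity.{0, w} (LieSuperalgebra.sl m n)) ∧
    (∀ n : ℕ, (LieSuperalgebra.osp 2 n).IsQuasireductive ∧
      (LieSuperalgebra.osp 2 n).HasRealGradingElement ∧
      LieSuperalgebra.VarietyDetectsProjectivity.{0, w} (LieSuperalgebra.osp 2 n)) ∧
    (∀ n : ℕ, (LieSuperalgebra.periplectic n).IsQuasireductive ∧
      (LieSuperalgebra.periplectic n).HasRealGradingElement ∧
      LieSuperalgebra.VarietyDetectsProjectivity.{0, w} (LieSuperalgebra.periplectic n)) := by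
  have detect := fun (g : LieSuperalgebra.{0}) (hg : g.HasRealGradingElement) =>
    LieSuperalgebra.varietyDetectsProjectivity_of_grading.{0, w} hg
  exact ⟨fun _ _ hg => LieSuperalgebra.varietyDetectsProjectivity_of_grading hg,
    fun m n => ⟨LieSuperalgebra.isQuasireductive_gl m n, LieSuperalgebra.hasRealGradingElement_gl m n,
      detect _ (LieSuperalgebra.hasRealGradingElement_gl m n)⟩,
    fun m n hmn => ⟨LieSuperalgebra.isQuasireductive_sl m n,
      LieSuperalgebra.hasRealGradingElement_sl m n hmn,
      detect _ (LieSuperalgebra.hasRealGradingElement_sl m n hmn)⟩,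
    fun n => ⟨LieSuperalgebra.isQuasireductive_osp 2 n, LieSuperalgebra.hasRealGradingElement_osp n,
      detect _ (LieSuperalgebra.hasRealGradingElement_osp n)⟩,
    fun n => ⟨LieSuperalgebra.isQuasireductive_periplectic n,
      LieSuperalgebra.hasRealGradingElement_periplectic n,
      detect _ (LieSuperalgebra.hasRealGradingElement_periplectic n)⟩⟩
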